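/- Let $m\ge 4$. A CSS code of length $n$ is given by binary matrices $\mathbf H_X,\mathbf H_Z$ with $n$ columns and $\mathbf H_X\mathbf H_Z^{T}=0$; its stabilizer group $S$ (modulo phases) is generated by the rows of $\mathbf H_X$, read as operators in $\{I,X\}^{\otimes n}$, and the rows of $\mathbf H_Z$, read as operators in $\{I,Z\}^{\otimes n}$. It is a $(2,m)$ CSS code if in both matrices every row has weight $m$ and every column has weight $2$; each matrix is then the incidence matrix of a graph whose vertices are the rows and whose edges are the columns (parallel edges being cycles of length 2). The code is proper if both graphs are connected and have girth exactly $m$. Over the quantum erasure channel of erasure probability $p$, each qubit is erased independently with probability $p$, and, given the set $A$ of erased qubits, the Pauli error $E$ (modulo phases) is uniform among the $4^{|A|}$ errors supported in $A$. A decoder is given $A$ and the syndrome of $E$ and proposes a Pauli correction $\tilde E$; it fails if $\tilde E E\notin S$. The decoding error probability of a code is the smallest failure probability over all decoders. The erasure threshold of a sequence of codes is the supremum of the $p\in[0,1]$ for which the decoding error probabilities tend to $0$ along the sequence. Let $a_k$ be the number of subtrees with $k$ edges of the infinite $m$-regular tree that contain a fixed vertex, and $S_{m-2}(z)=\sum_{k=0}^{m-2}\frac{a_k}{k+1}z^k$.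 Theorem. The equation $$1-\frac4m=(1-2p)\Big(\frac{4}{mp}\big(1-(1-p)^m S_{m-2}\big(p(1-p)^{m-2}\big)\big)-1\Big)$$ has exactly one solution $p_0\in(0,1/2]$, and for every sequence of proper $(2,m)$ CSS codes the erasure threshold is at most $p_0$. -/

import Mathlib

/-! ### Pauli errors up to phase -/

/-- The Pauli group on `n` qubits modulo phases, written additively as `𝔽₂ⁿ × 𝔽₂ⁿ`: the error with
vector `(x | z)` acts on qubit `i` as `I`, `X`, `Z` or `Y` when `(x i, z i)` is `(0,0)`, `(1,0)`,
`(0,1)` or `(1,1)`. Componentwise multiplication of errors is addition of vectors. -/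
abbrev PauliError (n : ℕ) : Type := (Fin n → ZMod 2) × (Fin n → ZMod 2)

namespace PauliError

/-- `0` if the two Pauli errors commute and `1` if they anticommute. -/
def commutator {n : ℕ} (E F : PauliError n) : ZMod 2 :=
  (∑ i, E.1 i * F.2 i) + ∑ i, E.2 i * F.1 i

/-- The set of qubits on which the error is not the identity. -/
def support {n : ℕ} (E : PauliError n) : Finset (Fin n) :=
  Finset.univ.filter fun i => E.1 i ≠ 0 ∨ E.2 i ≠ 0

end PauliError

/-! ### CSS codes -/

/-- A CSS code of length `n`, given by two binary matrices `HX`, `HZ` with mutually orthogonal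
rows. The rows of `HX` are generators in `{I, X}ⁿ` and those of `HZ` are generators in
`{I, Z}ⁿ`. -/
structure CSSCode where
  n : ℕ
  rX : ℕ
  rZ : ℕ
  HX : Matrix (Fin rX) (Fin n) (ZMod 2)
  HZ : Matrix (Fin rZ) (Fin n) (ZMod 2)
  orthogonal : HX * HZ.transpose = 0

namespace CSSCode

/-- The rows of the stabilizer matrix, as Pauli errors. -/
def generator (C : CSSCode) : Fin C.rX ⊕ Fin C.rZ → PauliError C.n :=
  Sum.elim (fun i => (C.HX i, 0)) (fun i => (0, C.HZ i))

/-- The stabilizer group (modulo phases). -/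
def stabilizer (C : CSSCode) : Submodule (ZMod 2) (PauliError C.n) :=
  Submodule.span (ZMod 2) (Set.range C.generator)

/-- The space in which syndromes live. -/
abbrev Syndrome (C : CSSCode) : Type := Fin C.rX ⊕ Fin C.rZ → ZMod 2

/-- The syndrome of a Pauli error: its `i`-th bit tells whether the error anticommutes with the
`i`-th generator. -/
def syndrome (C : CSSCode) (E : PauliError C.n) : C.Syndrome :=
  fun i => PauliError.commutator E (C.generator i)

/-! ### The quantum erasure channel and decoding -/

/-- The quantum erasure channel of erasure probability `p` on the qubits of `C`: the joint
probability that exactly the qubits of `A` are erased and that the Pauli error is `E`. Every qubit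
is erased independently with probability `p`; given `A`, the error is uniform among the
`4 ^ |A|` errors supported in `A`. -/
noncomputable def erasureProb (C : CSSCode) (p : ℝ) (A : Finset (Fin C.n))
    (E : PauliError C.n) : ℝ :=
  p ^ A.card * (1 - p) ^ (C.n - A.card) *
    (if E.support ⊆ A then (1 / 4 : ℝ) ^ A.card else 0)

/-- A decoder sees the erased set and the syndrome, and proposes a Pauli correction. -/
abbrev Decoder (C : CSSCode) : Type := Finset (Fin C.n) → C.Syndrome → PauliError C.n

open Classical in
/-- The probability that the decoder `D` fails on the erasure channel of probability `p`, that is,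
that the error followed by the proposed correction does not lie in the stabilizer group. -/
noncomputable def failureProb (C : CSSCode) (p : ℝ) (D : C.Decoder) : ℝ :=
  ∑ A : Finset (Fin C.n), ∑ E : PauliError C.n,
    if D A (C.syndrome E) + E ∈ C.stabilizer then 0 else C.erasureProb p A E

/-- The decoding error probability: the failure probability of the best decoder. (There are
finitely many decoders, so the infimum is a minimum.) -/
noncomputable def decodingErrorProb (C : CSSCode) (p : ℝ) : ℝ :=
  ⨅ D : C.Decoder, C.failureProb p D

/-- The erasure decoding threshold of a sequence of codes: the supremum of the erasure
probabilities at which the decoding error probability vanishes asymptotically. (The set contains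
`0` and is bounded by `1`.) -/
noncomputable def erasureThreshold (C : ℕ → CSSCode) : ℝ :=
  sSup {p : ℝ | 0 ≤ p ∧ p ≤ 1 ∧
    Filter.Tendsto (fun t => (C t).decodingErrorProb p) Filter.atTop (nhds 0)}

end CSSCode

/-! ### Proper `(2, m)` CSS codes -/

/-- A binary matrix all of whose rows have weight `m` and all of whose columns have weight `2`. -/
def IsTypeTwo (m : ℕ) {r n : ℕ} (H : Matrix (Fin r) (Fin n) (ZMod 2)) : Prop :=
  (∀ i, hammingNorm (fun j => H i j) = m) ∧ ∀ j, hammingNorm (fun i => H i j) = 2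

/-- Adjacency in the graph whose vertices are the rows of `H` and whose edges are the columns of
`H`: two distinct rows are adjacent if some column has a `1` in both of them. -/
def incidenceGraph {r n : ℕ} (H : Matrix (Fin r) (Fin n) (ZMod 2)) : SimpleGraph (Fin r) where
  Adj i i' := i ≠ i' ∧ ∃ j, H i j = 1 ∧ H i' j = 1
  symm := ⟨fun _ _ h => ⟨h.1.symm, h.2.imp fun _ hj => ⟨hj.2, hj.1⟩⟩⟩
  loopless := ⟨fun _ h => h.1 rfl⟩

open Classical in
/-- The length of a shortest cycle in the loopless multigraph with incidence matrix `H` (all columns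
having weight `2`): this is `2` if two different edges join the same two vertices, i.e. if two
columns are equal, and otherwise it is the girth of the simple graph. -/
noncomputable def incidenceGirth {r n : ℕ} (H : Matrix (Fin r) (Fin n) (ZMod 2)) : ℕ∞ :=
  if Function.Injective (fun j i => H i j) then (incidenceGraph H).egirth else 2

namespace CSSCode

/-- A `(2, m)` CSS code: both matrices have row weight `m` and column weight `2`. -/
def IsTwoM (C : CSSCode) (m : ℕ) : Prop := IsTypeTwo m C.HX ∧ IsTypeTwo m C.HZ

/-- A proper `(2, m)` CSS code: moreover both associated graphs are connected with girth `m`. -/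
structure IsProper (C : CSSCode) (m : ℕ) : Prop where
  isTwoM : C.IsTwoM m
  connectedX : (incidenceGraph C.HX).Connected
  connectedZ : (incidenceGraph C.HZ).Connected
  girthX : incidenceGirth C.HX = m
  girthZ : incidenceGirth C.HZ = m

end CSSCode

/-! ### Counting rooted subtrees of the regular tree -/

/-- Vertices of the infinite `m`-regular tree: words over an alphabet of `m` letters in which no two
consecutive letters agree. -/
def TreeVertex (m : ℕ) : Type := {l : List (Fin m) // l.IsChain (· ≠ ·)}

/-- The infinite `m`-regular tree: two words are adjacent when one is obtained from the other by
prepending one letter (so the Cayley graph of the free product of `m` groups of order `2`). -/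
def regularTree (m : ℕ) : SimpleGraph (TreeVertex m) where
  Adj u v := (∃ a, v.1 = a :: u.1) ∨ ∃ a, u.1 = a :: v.1
  symm := ⟨fun _ _ h => h.symm⟩
  loopless := ⟨fun u h => by
    rcases h with ⟨a, h⟩ | ⟨a, h⟩ <;> exact absurd (congrArg List.length h) (by simp)⟩

/-- The root of the tree: the empty word. -/
def treeRoot (m : ℕ) : TreeVertex m := ⟨[], List.IsChain.nil⟩

/-- `a_k`: the number of subtrees of the `m`-regular tree that have `k` edges and contain the
root. -/
noncomputable def numSubtrees (m k : ℕ) : ℕ :=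
  Set.ncard {T : (regularTree m).Subgraph |
    treeRoot m ∈ T.verts ∧ T.coe.IsTree ∧ T.edgeSet.encard = k}

/-- `S_δ(z) = ∑_{k=0}^{δ} a_k z^k / (k+1)`. -/
noncomputable def subtreeSum (m δ : ℕ) (z : ℝ) : ℝ :=
  ∑ k ∈ Finset.range (δ + 1), (numSubtrees m k : ℝ) / ((k : ℝ) + 1) * z ^ k

/-- The bound on the achievable rates of proper `(2, m)` CSS codes over the erasure channel of
probability `p`. -/
noncomputable def rateBound (m : ℕ) (p : ℝ) : ℝ :=
  (1 - 2 * p) *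
    (4 / ((m : ℝ) * p) *
      (1 - (1 - p) ^ m * subtreeSum m (m - 2) (p * (1 - p) ^ (m - 2))) - 1)

/-! Let ρ(A) be the rank of the stabilizer matrix restricted to the qubits of A. If A is
correctable, every undetectable error supported in A is a stabilizer supported in A. Comparing
dimensions gives 2|A| + ρ(Aᶜ) ≤ ρ(univ) + ρ(A) (`uncorrectable_of_restrictedRank`, contrapositive).
A decoder fails with at least half the probability of an uncorrectable erasure
(`uncorrectableProb_le_failureProb`), so when its error tends to 0 this inequality holds in
expectation up to o(n). The expectation ψ(p) of ρ is concave because rank is submodular. Concavity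
at p, 1 - p, 1 eliminates ψ(1 - p) and leaves n - ρ(univ) ≤ (1 - 2p)(ψ(p)/p - n) + o(n)
(`sub_restrictedRank_le`). For p ≥ 1/2, the same inequality for A and Aᶜ shows that one of the two
is uncorrectable.

To bound ψ, note that an incidence matrix over 𝔽₂ restricted to the columns A has rank at most the
number of vertices minus the number of components of the graph with edges A. The expected number of
components is the sum over vertices of the expected inverse cluster size. Clusters that are trees
with at most m - 2 edges lie below the girth, so they look as in the m-regular tree and contribute
f(p) = (1 - p)^m S_{m-2}(p(1 - p)^{m-2}) (`IsTypeTwo.expectation_colRank_le`). Together with rX + rZ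
= 4n/m, this turns the inequality into 1 - 4/m ≤ `rateBound m p` in the limit.

It remains to see that `rateBound` crosses the level 1 - 4/m exactly once. For p ≤ 1/(m-1), f(p) ≤ 1
- mp/2 and the bound is strictly above the level (`lt_rateBound`). On [1/(m-1), 1/2], (1 - f(p))/p
is nonincreasing (`antitoneOn_one_sub_invClusterSize_div`), by comparing p with the subcritical x
for which x(1 - x)^{m-2} has the same value. Both facts rest on one inequality: the probabilities of
the finite clusters of the root in the tree add up to at most 1. -/

namespace Percolation

/-! ### Expectations over random subsets, as polynomials in p -/

open Finset Polynomial

variable {α : Type*}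

/-- The expectation of `f A`, as a polynomial in `p`, when `A ⊆ s` contains each element of `s`
independently with probability `p`. -/
noncomputable def expectation (s : Finset α) (f : Finset α → ℝ) : ℝ[X] :=
  ∑ A ∈ s.powerset, C (f A) * (X ^ A.card * (1 - X) ^ (s.card - A.card))

theorem eval_expectation (s : Finset α) (f : Finset α → ℝ) (p : ℝ) :
    (expectation s f).eval p =
      ∑ A ∈ s.powerset, p ^ A.card * (1 - p) ^ (s.card - A.card) * f A := by
  simp only [expectation, eval_finsetSum]
  refine sum_congr rfl fun A _ => ?_
  simp
  ring

theorem expectation_add (s : Finset α) (f g : Finset α → ℝ) :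
    expectation s (fun A => f A + g A) = expectation s f + expectation s g := by
  simp [expectation, add_mul, sum_add_distrib]

theorem expectation_sub (s : Finset α) (f g : Finset α → ℝ) :
    expectation s (fun A => f A - g A) = expectation s f - expectation s g := by
  simp [expectation, sub_mul, sum_sub_distrib]

theorem expectation_const_mul (s : Finset α) (c : ℝ) (f : Finset α → ℝ) :
    expectation s (fun A => c * f A) = C c * expectation s f := by
  simp [expectation, mul_sum, mul_assoc]

theorem expectation_sum {κ : Type*} (s : Finset α) (t : Finset κ) (f : κ → Finset α → ℝ) :
    expectation s (fun A => ∑ k ∈ t, f k A) = ∑ k ∈ t, expectation s (f k) := by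
  simp only [expectation, map_sum, sum_mul]
  exact sum_comm

theorem weight_nonneg {p : ℝ} (h0 : 0 ≤ p) (h1 : p ≤ 1) (a b : ℕ) : 0 ≤ p ^ a * (1 - p) ^ b :=
  mul_nonneg (pow_nonneg h0 _) (pow_nonneg (by linarith) _)

theorem eval_expectation_mono {s : Finset α} {f g : Finset α → ℝ} {p : ℝ} (h0 : 0 ≤ p)
    (h1 : p ≤ 1) (h : ∀ A ⊆ s, f A ≤ g A) :
    (expectation s f).eval p ≤ (expectation s g).eval p := by
  rw [eval_expectation, eval_expectation]
  exact sum_le_sum fun A hA =>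
    mul_le_mul_of_nonneg_left (h A (mem_powerset.1 hA)) (weight_nonneg h0 h1 _ _)

variable [DecidableEq α]

/-- Conditioning on whether i belongs to the random set; this recursion drives the inductions below.
-/
theorem expectation_insert {s : Finset α} {i : α} (hi : i ∉ s) (f : Finset α → ℝ) :
    expectation (insert i s) f =
      (1 - X) * expectation s f + X * expectation s (fun A => f (insert i A)) := by
  unfold expectation
  rw [sum_powerset_insert hi, mul_sum, mul_sum]
  congr 1
  · refine sum_congr rfl fun A hA => ?_
    have := card_le_card (mem_powerset.1 hA)
    rw [card_insert_of_notMem hi, Nat.sub_add_comm this, pow_succ]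
    ring
  · refine sum_congr rfl fun A hA => ?_
    have hiA : i ∉ A := fun h => hi (mem_powerset.1 hA h)
    rw [card_insert_of_notMem hi, card_insert_of_notMem hiA, Nat.add_sub_add_right, pow_succ]
    ring

theorem expectation_const (s : Finset α) (c : ℝ) : expectation s (fun _ => c) = C c := by
  induction s using Finset.induction_on with
  | empty => simp [expectation]
  | insert i s hi ih => rw [expectation_insert hi, ih]; ring

theorem eval_derivative_expectation_nonneg (s : Finset α) (f : Finset α → ℝ)
    (hf : ∀ A B, A ⊆ B → B ⊆ s → f A ≤ f B) {p : ℝ} (h0 : 0 ≤ p) (h1 : p ≤ 1) :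
    0 ≤ (derivative (expectation s f)).eval p := by
  induction s using Finset.induction_on generalizing f with
  | empty => simp [expectation]
  | insert i s hi ih =>
    rw [expectation_insert hi]
    have e0 := ih f fun A B h h' => hf A B h (h'.trans (subset_insert _ _))
    have e1 := ih (fun A => f (insert i A)) fun A B h h' =>
      hf _ _ (insert_subset_insert i h) (insert_subset_insert i h')
    have e2 : (expectation s f).eval p ≤ (expectation s fun A => f (insert i A)).eval p :=
      eval_expectation_mono h0 h1 fun A hA =>
        hf _ _ (subset_insert _ _) (insert_subset_insert i hA)
    simp only [derivative_add, derivative_mul, derivative_sub, derivative_one, derivative_X,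
      eval_add, eval_mul, eval_sub, eval_one, eval_X, eval_zero]
    have := mul_nonneg h0 e1
    have := mul_nonneg (sub_nonneg.2 h1) e0
    linarith

/-- Differentiating the recursion twice leaves the second derivatives of the two conditional
expectations, plus twice the derivative of the expected increment at i. Submodularity makes this
increment decreasing in A, so the monotone case applies to its negative. -/
theorem eval_derivative2_expectation_nonpos (s : Finset α) (f : Finset α → ℝ)
    (hf : ∀ A B i, A ⊆ B → B ⊆ s → i ∈ s → f (insert i B) - f B ≤ f (insert i A) - f A)
    {p : ℝ} (h0 : 0 ≤ p) (h1 : p ≤ 1) :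
    (derivative (derivative (expectation s f))).eval p ≤ 0 := by
  induction s using Finset.induction_on generalizing f with
  | empty => simp [expectation]
  | insert i s hi ih =>
    have e0 := ih f fun A B j h h' hj => hf A B j h (h'.trans (subset_insert _ _))
      (mem_insert_of_mem hj)
    have e1 := ih (fun A => f (insert i A)) fun A B j h h' hj => by
      have := hf _ _ j (insert_subset_insert i h) (insert_subset_insert i h') (mem_insert_of_mem hj)
      simpa only [insert_comm j i] using this
    have e2 := eval_derivative_expectation_nonneg s (fun A => f A - f (insert i A))
      (fun A B h h' => by
        have := hf A B i h (h'.trans (subset_insert _ _)) (mem_insert_self _ _)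
        linarith) h0 h1
    rw [expectation_sub] at e2
    rw [expectation_insert hi]
    simp only [derivative_add, derivative_mul, derivative_sub, derivative_one, derivative_X,
      eval_add, eval_mul, eval_sub, eval_one, eval_X, eval_zero, derivative_zero] at e2 ⊢
    have := mul_nonneg h0 (neg_nonneg.2 e1)
    have := mul_nonneg (sub_nonneg.2 h1) (neg_nonneg.2 e0)
    linarith

theorem expectation_monotoneOn (s : Finset α) (f : Finset α → ℝ)
    (hf : ∀ A B, A ⊆ B → B ⊆ s → f A ≤ f B) :
    MonotoneOn (fun p => (expectation s f).eval p) (Set.Icc 0 1) := by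
  refine monotoneOn_of_deriv_nonneg (convex_Icc _ _) (Polynomial.continuous _).continuousOn
    (Polynomial.differentiable _).differentiableOn fun p hp => ?_
  rw [interior_Icc] at hp
  rw [Polynomial.deriv]
  exact eval_derivative_expectation_nonneg s f hf hp.1.le hp.2.le

theorem expectation_concaveOn (s : Finset α) (f : Finset α → ℝ)
    (hf : ∀ A B i, A ⊆ B → B ⊆ s → i ∈ s → f (insert i B) - f B ≤ f (insert i A) - f A) :
    ConcaveOn ℝ (Set.Icc 0 1) (fun p => (expectation s f).eval p) := by
  have hd : deriv (fun p => (expectation s f).eval p) =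
      fun p => (derivative (expectation s f)).eval p := by
    ext p; exact Polynomial.deriv _
  refine concaveOn_of_deriv2_nonpos (convex_Icc _ _) (Polynomial.continuous _).continuousOn
    (Polynomial.differentiable _).differentiableOn ?_ fun p hp => ?_
  · rw [hd]; exact (Polynomial.differentiable _).differentiableOn
  · rw [interior_Icc] at hp
    rw [Function.iterate_succ, Function.iterate_one, Function.comp_apply, hd, Polynomial.deriv]
    exact eval_derivative2_expectation_nonpos s f hf hp.1.le hp.2.le

/-- The probability that `A` contains `I` and avoids `J`. -/
theorem eval_expectation_cylinder (s I J : Finset α) (hI : I ⊆ s) (hJ : J ⊆ s)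
    (hIJ : Disjoint I J) (p : ℝ) :
    (expectation s fun A => if I ⊆ A ∧ Disjoint J A then 1 else 0).eval p =
      p ^ I.card * (1 - p) ^ J.card := by
  -- Expanding this product gives one term per subset A; the zeros kill every A that meets J or
  -- misses a point of I.
  have key := prod_add (fun i => if i ∈ J then (0 : ℝ) else p)
    (fun i => if i ∈ I then (0 : ℝ) else 1 - p) s
  rw [eval_expectation]
  trans ∏ i ∈ s, ((if i ∈ J then (0 : ℝ) else p) + if i ∈ I then (0 : ℝ) else 1 - p)
  · rw [key]
    refine sum_congr rfl fun A hA => ?_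
    rw [mem_powerset] at hA
    split_ifs with h
    · rw [prod_congr rfl (g := fun _ => p) fun i hi => if_neg fun h' =>
        (disjoint_left.1 h.2 h' hi), prod_congr rfl (g := fun _ => 1 - p) fun i hi => if_neg fun h' =>
        (mem_sdiff.1 hi).2 (h.1 h'), prod_const, prod_const, card_sdiff_of_subset hA, mul_one]
    · rw [mul_zero, eq_comm, mul_eq_zero]
      by_cases h1 : I ⊆ A
      · left
        have h2 : ¬ Disjoint J A := fun h' => h ⟨h1, h'⟩
        obtain ⟨i, hi, hi'⟩ := not_disjoint_iff.1 h2
        exact prod_eq_zero hi' (if_pos hi)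
      · right
        obtain ⟨i, hi, hi'⟩ := not_subset.1 h1
        exact prod_eq_zero (mem_sdiff.2 ⟨hI hi, hi'⟩) (if_pos hi)
  · rw [← sdiff_union_of_subset (union_subset hI hJ), prod_union sdiff_disjoint,
      prod_union hIJ, prod_eq_one, one_mul]
    · congr 1
      · exact prod_eq_pow_card fun i hi => by
          rw [if_neg (disjoint_left.1 hIJ hi), if_pos hi, add_zero]
      · exact prod_eq_pow_card fun i hi => by
          rw [if_pos hi, if_neg (disjoint_right.1 hIJ hi), zero_add]
    · intro i hi
      simp only [mem_sdiff, mem_union, not_or] at hi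
      rw [if_neg hi.2.2, if_neg hi.2.1]
      ring

theorem eval_expectation_card (s : Finset α) (p : ℝ) :
    (expectation s fun A => (A.card : ℝ)).eval p = p * s.card := by
  induction s using Finset.induction_on with
  | empty => simp [expectation]
  | insert i s hi ih =>
    have : expectation s (fun A => ((insert i A).card : ℝ)) =
        expectation s fun A => (A.card : ℝ) + 1 := by
      refine sum_congr rfl fun A hA => ?_
      simp only
      rw [card_insert_of_notMem fun h => hi (mem_powerset.1 hA h), Nat.cast_succ]
    rw [expectation_insert hi, this, expectation_add, expectation_const]
    simp only [eval_add, eval_mul, eval_sub, eval_one, eval_X, ih, eval_C,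
      card_insert_of_notMem hi]
    push_cast
    ring

theorem eval_expectation_compl [Fintype α] (f : Finset α → ℝ) (p : ℝ) :
    (expectation univ fun A => f Aᶜ).eval p = (expectation univ f).eval (1 - p) := by
  rw [eval_expectation, eval_expectation, powerset_univ]
  refine Fintype.sum_equiv (compl_involutive.toPerm (compl : Finset α → Finset α)) _ _ fun A => ?_
  have h := card_le_univ A
  rw [Function.Involutive.coe_toPerm, card_compl, card_univ, Nat.sub_sub_self h, sub_sub_cancel]
  ring

end Percolation

/-! ### Ranks of sets of columns -/

namespace Matrix

open _root_.Module Submodule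

variable {V E K : Type*} [Field K]

/-- The rank of the set of columns of `H` indexed by `A`. -/
noncomputable def colRank [Fintype E] (H : Matrix V E K) (A : Finset E) : ℕ :=
  (H.submatrix id (Subtype.val : A → E)).rank

/-- The span of the columns of `H` indexed by `A`. -/
def colSpan (H : Matrix V E K) (A : Finset E) : Submodule K (V → K) :=
  span K ((fun j i => H i j) '' (A : Set E))

theorem colSpan_eq_span_range (H : Matrix V E K) (A : Finset E) :
    H.colSpan A = span K (Set.range fun (j : A) i => H i j) := by
  unfold colSpan
  congr 1
  ext x
  simp

theorem colRank_eq_finrank_colSpan [Fintype E] (H : Matrix V E K) (A : Finset E) :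
    H.colRank A = finrank K (H.colSpan A) := by
  rw [colRank, rank_eq_finrank_span_cols, colSpan_eq_span_range]
  rfl

theorem colSpan_mono (H : Matrix V E K) {A B : Finset E} (h : A ⊆ B) :
    H.colSpan A ≤ H.colSpan B :=
  span_mono (Set.image_mono (by exact_mod_cast h))

theorem colSpan_union [DecidableEq E] (H : Matrix V E K) (A B : Finset E) :
    H.colSpan (A ∪ B) = H.colSpan A ⊔ H.colSpan B := by
  rw [colSpan, Finset.coe_union, Set.image_union, span_union, colSpan, colSpan]

variable [Fintype E]

/-- The vectors supported in `A`. -/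
def supportedIn (K : Type*) [Field K] (A : Finset E) : Submodule K (E → K) where
  carrier := {x | ∀ j ∉ A, x j = 0}
  add_mem' hx hy j hj := by simp [hx j hj, hy j hj]
  zero_mem' _ _ := rfl
  smul_mem' c x hx j hj := by simp [hx j hj]

/-- Rank-nullity for the submatrix on A, whose kernel embeds through extension by zero. -/
theorem finrank_ker_inf_supportedIn (H : Matrix V E K) (A : Finset E) :
    A.card ≤ finrank K ↑(LinearMap.ker H.mulVecLin ⊓ supportedIn K A) + H.colRank A := by
  classical
  set M := H.submatrix id (Subtype.val : A → E)
  have h1 := LinearMap.finrank_range_add_finrank_ker M.mulVecLin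
  rw [finrank_fintype_fun_eq_card, Fintype.card_coe] at h1
  have hinj : Function.Injective (Function.ExtendByZero.linearMap K (Subtype.val : A → E)) :=
    Function.extend_injective Subtype.val_injective _
  have h2 : (LinearMap.ker M.mulVecLin).map (Function.ExtendByZero.linearMap K Subtype.val) ≤
      LinearMap.ker H.mulVecLin ⊓ supportedIn K A := by
    rintro _ ⟨y, hy, rfl⟩
    refine ⟨?_, fun j hj => ?_⟩
    · rw [SetLike.mem_coe, LinearMap.mem_ker, mulVecLin_apply] at hy ⊢
      ext i
      rw [← congrFun hy i]
      simp only [mulVec, dotProduct, M, submatrix_apply, id]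
      rw [← Finset.sum_subset (Finset.subset_univ A), ← Finset.sum_coe_sort A]
      · refine Finset.sum_congr rfl fun j _ => ?_
        congr 1
        exact Subtype.val_injective.extend_apply y 0 j
      · intro j _ hj
        rw [Function.ExtendByZero.linearMap_apply, Function.extend_apply' _ _ _ (by simpa using hj)]
        simp
    · rw [Function.ExtendByZero.linearMap_apply, Function.extend_apply' _ _ _ (by simpa using hj)]
      rfl
  have h3 := finrank_mono h2
  have h4 := (Submodule.equivMapOfInjective _ hinj (LinearMap.ker M.mulVecLin)).finrank_eq
  have h5 : H.colRank A = finrank K (LinearMap.range M.mulVecLin) := rfl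
  omega

variable [Fintype V]

theorem colRank_le_card (H : Matrix V E K) (A : Finset E) : H.colRank A ≤ Fintype.card V :=
  rank_le_card_height _

theorem colRank_submodular [DecidableEq E] (H : Matrix V E K) {A B : Finset E} (h : A ⊆ B)
    (i : E) :
    (H.colRank (insert i B) : ℝ) - H.colRank B ≤ H.colRank (insert i A) - H.colRank A := by
  have h1 : insert i B = B ∪ insert i A := by
    ext x
    simp only [Finset.mem_insert, Finset.mem_union]
    have := @h x
    tauto
  have h2 := finrank_sup_add_finrank_inf_eq (H.colSpan B) (H.colSpan (insert i A))
  rw [← colSpan_union, ← h1] at h2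
  have h3 : finrank K (H.colSpan A) ≤ finrank K ↑(H.colSpan B ⊓ H.colSpan (insert i A)) :=
    finrank_mono (le_inf (H.colSpan_mono h) (H.colSpan_mono (Finset.subset_insert _ _)))
  simp only [colRank_eq_finrank_colSpan]
  have h4 : (finrank K (H.colSpan (insert i B)) : ℝ) + finrank K (H.colSpan A) ≤
      finrank K (H.colSpan B) + finrank K (H.colSpan (insert i A)) := by
    exact_mod_cast (by omega)
  linarith

/-- Rank-nullity for the restriction of the row space to Aᶜ: its image is the row space of the
submatrix on Aᶜ, and its kernel consists of the row vectors supported in A. -/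
theorem finrank_rowSpace_inf_supportedIn [DecidableEq E] (H : Matrix V E K) (A : Finset E) :
    finrank K ↑(LinearMap.range H.vecMulLinear ⊓ supportedIn K A) + H.colRank Aᶜ ≤
      H.colRank Finset.univ := by
  set R := LinearMap.range H.vecMulLinear
  set f := (LinearMap.funLeft K K (Subtype.val : ↥(Aᶜ) → E)).domRestrict R
  have h1 := LinearMap.finrank_range_add_finrank_ker f
  have h2 : finrank K R = H.colRank Finset.univ := by
    have h := rank_submatrix H (Equiv.refl V) (Equiv.subtypeUnivEquiv Finset.mem_univ)
    rw [show R = LinearMap.range Hᵀ.mulVecLin by rw [mulVecLin_transpose]]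
    exact (rank_transpose H).trans h.symm
  have h3 : finrank K (LinearMap.range f) = H.colRank Aᶜ := by
    have h : LinearMap.range f =
        LinearMap.range (H.submatrix id (Subtype.val : ↥(Aᶜ) → E))ᵀ.mulVecLin := by
      rw [mulVecLin_transpose]
      ext x
      constructor
      · rintro ⟨⟨_, y, rfl⟩, rfl⟩
        exact ⟨y, rfl⟩
      · rintro ⟨y, rfl⟩
        exact ⟨⟨_, y, rfl⟩, rfl⟩
    rw [colRank, ← rank_transpose, rank]
    exact (LinearEquiv.ofEq _ _ h).finrank_eq
  have h4 : (R ⊓ supportedIn K A) ≤ (LinearMap.ker f).map R.subtype := by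
    rintro x ⟨hx, hx'⟩
    refine ⟨⟨x, hx⟩, ?_, rfl⟩
    rw [SetLike.mem_coe, LinearMap.mem_ker]
    ext j
    exact hx' _ (Finset.mem_compl.1 j.2)
  have h5 := finrank_mono h4
  have h6 := finrank_map_le R.subtype (LinearMap.ker f)
  omega

end Matrix

/-! ### Uncorrectable erasures and decoding failure -/

namespace CSSCode

open Finset Percolation

variable (C : CSSCode)

/-- Some undetectable error supported in `A` is not a stabilizer. -/
def Uncorrectable (A : Finset (Fin C.n)) : Prop :=
  ∃ e : PauliError C.n, e.support ⊆ A ∧ C.syndrome e = 0 ∧ e ∉ C.stabilizer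

theorem Uncorrectable.mono {C : CSSCode} {A B : Finset (Fin C.n)} (h : C.Uncorrectable A)
    (hAB : A ⊆ B) : C.Uncorrectable B := by
  obtain ⟨e, h1, h2⟩ := h
  exact ⟨e, h1.trans hAB, h2⟩

theorem stabilizer_le : C.stabilizer ≤
    (LinearMap.range C.HX.vecMulLinear).prod (LinearMap.range C.HZ.vecMulLinear) := by
  refine Submodule.span_le.2 ?_
  rintro _ ⟨i | i, rfl⟩
  · refine ⟨⟨Pi.single i 1, ?_⟩, Submodule.zero_mem _⟩
    simp [generator]
    rfl
  · refine ⟨Submodule.zero_mem _, ⟨Pi.single i 1, ?_⟩⟩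
    simp [generator]
    rfl

/-- The rank of the stabilizer matrix restricted to the qubits of `A`. -/
noncomputable def restrictedRank (A : Finset (Fin C.n)) : ℕ := C.HX.colRank A + C.HZ.colRank A

/-- Otherwise, inside A, the kernel of `HZ` lies in the row space of `HX` and conversely. The
kernels supported in A have total dimension at least 2|A| - ρ(A), the row spaces at most ρ(univ) -
ρ(Aᶜ). -/
theorem uncorrectable_of_restrictedRank {A : Finset (Fin C.n)}
    (h : C.restrictedRank univ + C.restrictedRank A < 2 * A.card + C.restrictedRank Aᶜ) :
    C.Uncorrectable A := by
  by_contra hA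
  have hX : LinearMap.ker C.HZ.mulVecLin ⊓ Matrix.supportedIn (ZMod 2) A ≤
      LinearMap.range C.HX.vecMulLinear ⊓ Matrix.supportedIn (ZMod 2) A := by
    rintro x ⟨hx, hx'⟩
    refine ⟨?_, hx'⟩
    by_contra hx2
    refine hA ⟨(x, 0), fun j hj => ?_, ?_, fun hs => hx2 (C.stabilizer_le hs).1⟩
    · by_contra hj'
      simp [PauliError.support, hx' j hj'] at hj
    · ext (i | i)
      · simp [syndrome, PauliError.commutator, generator]
      · have := congrFun (LinearMap.mem_ker.1 hx) i
        simpa [syndrome, PauliError.commutator, generator, Matrix.mulVec, dotProduct, mul_comm]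
          using this
  have hZ : LinearMap.ker C.HX.mulVecLin ⊓ Matrix.supportedIn (ZMod 2) A ≤
      LinearMap.range C.HZ.vecMulLinear ⊓ Matrix.supportedIn (ZMod 2) A := by
    rintro x ⟨hx, hx'⟩
    refine ⟨?_, hx'⟩
    by_contra hx2
    refine hA ⟨(0, x), fun j hj => ?_, ?_, fun hs => hx2 (C.stabilizer_le hs).2⟩
    · by_contra hj'
      simp [PauliError.support, hx' j hj'] at hj
    · ext (i | i)
      · have := congrFun (LinearMap.mem_ker.1 hx) i
        simpa [syndrome, PauliError.commutator, generator, Matrix.mulVec, dotProduct, mul_comm]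
          using this
      · simp [syndrome, PauliError.commutator, generator]
  have h1 := Submodule.finrank_mono hX
  have h2 := Submodule.finrank_mono hZ
  have h3 := C.HX.finrank_ker_inf_supportedIn A
  have h4 := C.HZ.finrank_ker_inf_supportedIn A
  have h5 := C.HX.finrank_rowSpace_inf_supportedIn A
  have h6 := C.HZ.finrank_rowSpace_inf_supportedIn A
  unfold restrictedRank at h
  omega

theorem card_supported {n : ℕ} (A : Finset (Fin n)) :
    (univ.filter fun E : PauliError n => E.support ⊆ A).card = 4 ^ A.card := by
  classical
  set t : Finset (Fin n → ZMod 2) := Fintype.piFinset fun i => if i ∈ A then univ else {0}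
  have h : (univ.filter fun E : PauliError n => E.support ⊆ A) = t ×ˢ t := by
    ext E
    simp only [mem_filter, mem_univ, true_and, mem_product, t, Fintype.mem_piFinset,
      PauliError.support, subset_iff, ← forall_and]
    refine forall_congr' fun i => ?_
    by_cases hi : i ∈ A <;> simp [hi, or_iff_not_imp_left]
  have h2 : t.card = 2 ^ A.card := by
    rw [Fintype.card_piFinset, ← prod_subset (subset_univ A)]
    · exact prod_eq_pow_card fun i hi => by simp [hi]
    · intro i _ hi
      simp [hi]
  rw [h, card_product, h2, ← mul_pow]
  norm_num

theorem support_add_subset {n : ℕ} {A : Finset (Fin n)} {E F : PauliError n}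
    (hE : E.support ⊆ A) (hF : F.support ⊆ A) : (E + F).support ⊆ A := by
  intro i hi
  by_contra h
  have h1 : i ∉ E.support := fun h' => h (hE h')
  have h2 : i ∉ F.support := fun h' => h (hF h')
  simp only [PauliError.support, mem_filter, mem_univ, true_and, not_or, not_not] at h1 h2 hi
  simp [h1, h2] at hi

theorem syndrome_add (E F : PauliError C.n) :
    C.syndrome (E + F) = C.syndrome E + C.syndrome F := by
  ext i
  simp only [syndrome, PauliError.commutator, Prod.fst_add, Prod.snd_add, Pi.add_apply, add_mul,
    sum_add_distrib]
  ring

theorem add_self {n : ℕ} (e : PauliError n) : e + e = 0 := by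
  ext i <;> exact CharTwo.add_self_eq_zero _

open Classical in
/-- The probability that the set of erased qubits is not correctable. -/
noncomputable def uncorrectableProb (p : ℝ) : ℝ :=
  (expectation univ fun A : Finset (Fin C.n) => if C.Uncorrectable A then (1 : ℝ) else 0).eval p

open Classical in
-- If e is undetectable, supported in A and not a stabilizer, then E and E + e are equally likely
-- with the same syndrome, and no proposed correction suits both.
theorem uncorrectableProb_le_failureProb {p : ℝ} (h0 : 0 ≤ p) (h1 : p ≤ 1) (D : C.Decoder) :
    C.uncorrectableProb p / 2 ≤ C.failureProb p D := by
  rw [uncorrectableProb, eval_expectation, sum_div, powerset_univ, failureProb]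
  refine sum_le_sum fun A _ => ?_
  rw [card_univ, Fintype.card_fin]
  set w := p ^ A.card * (1 - p) ^ (C.n - A.card) with hw
  have hw0 : 0 ≤ w := weight_nonneg h0 h1 _ _
  split_ifs with hA
  · obtain ⟨e, he, hes, heS⟩ := hA
    set F := univ.filter fun E : PauliError C.n => E.support ⊆ A
    set b : PauliError C.n → ℝ := fun E => if D A (C.syndrome E) + E ∈ C.stabilizer then 0 else 1
    have hb : ∀ E, 1 ≤ b E + b (E + e) := by
      intro E
      have hs : C.syndrome (E + e) = C.syndrome E := by rw [syndrome_add, hes, add_zero]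
      simp only [b, hs]
      split_ifs with h2 h3
      · exfalso
        have := C.stabilizer.sub_mem h3 h2
        apply heS
        convert this using 1
        abel
      all_goals norm_num
    have hsum : ∑ E ∈ F, b (E + e) = ∑ E ∈ F, b E := by
      refine sum_nbij' (· + e) (· + e) ?_ ?_ ?_ ?_ ?_
      · intro E hE
        simp only [F, mem_filter, mem_univ, true_and] at hE ⊢
        exact support_add_subset hE he
      · intro E hE
        simp only [F, mem_filter, mem_univ, true_and] at hE ⊢
        exact support_add_subset hE he
      · intro E _
        rw [add_assoc, add_self, add_zero]
      · intro E _
        rw [add_assoc, add_self, add_zero]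
      · intro E _
        rfl
    have hF : (4 : ℝ) ^ A.card ≤ 2 * ∑ E ∈ F, b E := by
      calc (4 : ℝ) ^ A.card = ∑ E ∈ F, (1 : ℝ) := by
            rw [sum_const, card_supported]; simp
        _ ≤ ∑ E ∈ F, (b E + b (E + e)) := sum_le_sum fun E _ => hb E
        _ = _ := by rw [sum_add_distrib, hsum]; ring
    have hL : (∑ E : PauliError C.n, if D A (C.syndrome E) + E ∈ C.stabilizer then 0
        else C.erasureProb p A E) = w * (1 / 4) ^ A.card * ∑ E ∈ F, b E := by
      rw [sum_filter, mul_sum]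
      refine sum_congr rfl fun E _ => ?_
      simp only [b, erasureProb, ← hw]
      split_ifs <;> simp
    rw [hL]
    have h4 : (1 / 4 : ℝ) ^ A.card * 4 ^ A.card = 1 := by rw [← mul_pow]; norm_num
    have h5 : (1 / 4 : ℝ) ^ A.card * 4 ^ A.card ≤ (1 / 4 : ℝ) ^ A.card * (2 * ∑ E ∈ F, b E) :=
      mul_le_mul_of_nonneg_left hF (by positivity)
    rw [h4] at h5
    have h6 := mul_le_mul_of_nonneg_left h5 hw0
    linarith
  · rw [mul_zero, zero_div]
    refine sum_nonneg fun E _ => ?_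
    split_ifs
    · exact le_rfl
    · rw [erasureProb, ← hw]
      split_ifs <;> positivity

theorem uncorrectableProb_le_decodingErrorProb {p : ℝ} (h0 : 0 ≤ p) (h1 : p ≤ 1) :
    C.uncorrectableProb p ≤ 2 * C.decodingErrorProb p := by
  have : C.uncorrectableProb p / 2 ≤ C.decodingErrorProb p :=
    le_ciInf fun D => C.uncorrectableProb_le_failureProb h0 h1 D
  linarith

end CSSCode

/-! ### Rooted subtrees of the regular tree -/

namespace RegularTree

open Finset Percolation

variable {m : ℕ}

/-- Finite subtrees of the `m`-regular tree that contain the root, given by their vertices. -/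
structure IsRootedTree (W : Finset (List (Fin m))) : Prop where
  nil_mem : [] ∈ W
  isChain : ∀ l ∈ W, l.IsChain (· ≠ ·)
  of_cons : ∀ a l, a :: l ∈ W → l ∈ W

theorem IsRootedTree.drop_mem {W : Finset (List (Fin m))} (hW : IsRootedTree W)
    {l : List (Fin m)} (hl : l ∈ W) (i : ℕ) : l.drop i ∈ W := by
  induction i with
  | zero => simpa using hl
  | succ i ih =>
    rw [← List.tail_drop]
    cases h : l.drop i with
    | nil => exact hW.nil_mem
    | cons a t => exact hW.of_cons a t (h ▸ ih)

theorem IsRootedTree.length_lt {W : Finset (List (Fin m))} (hW : IsRootedTree W)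
    {l : List (Fin m)} (hl : l ∈ W) : l.length < W.card := by
  have h : ((range (l.length + 1)).image fun i => l.drop i) ⊆ W := by
    intro x hx
    obtain ⟨i, -, rfl⟩ := mem_image.1 hx
    exact hW.drop_mem hl i
  have h2 := card_le_card h
  rw [card_image_of_injOn, card_range] at h2
  · exact h2
  · intro i hi j hj hij
    have := congrArg List.length hij
    simp only [coe_range, Set.mem_Iio, List.length_drop] at hi hj this
    omega

/-- The words of length at most `L`. -/
noncomputable def words (m L : ℕ) : Finset (List (Fin m)) :=
  (List.finite_length_le (Fin m) L).toFinset

theorem mem_words {L : ℕ} {l : List (Fin m)} : l ∈ words m L ↔ l.length ≤ L := by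
  simp [words]

open Classical in
/-- The rooted trees with `k` edges. -/
noncomputable def rootedTrees (m k : ℕ) : Finset (Finset (List (Fin m))) :=
  (words m k).powerset.filter fun W => IsRootedTree W ∧ W.card = k + 1

theorem mem_rootedTrees {k : ℕ} {W : Finset (List (Fin m))} :
    W ∈ rootedTrees m k ↔ IsRootedTree W ∧ W.card = k + 1 := by
  simp only [rootedTrees, mem_filter, mem_powerset, and_iff_right_iff_imp]
  rintro ⟨hW, hk⟩ l hl
  have := hW.length_lt hl
  rw [mem_words]
  omega

theorem rootedTrees_pairwiseDisjoint (m : ℕ) (s : Set ℕ) :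
    s.PairwiseDisjoint (rootedTrees m) := by
  intro i _ j _ hij
  refine disjoint_left.2 fun W hi hj => hij ?_
  rw [mem_rootedTrees] at hi hj
  omega

/-! ### Subtrees as sets of words -/

/-- A walk in T from u to the root must leave the set of descendants of u (the words with suffix u),
and the only edge of the tree that does so joins u to its tail. -/
theorem adj_of_cons_mem {T : (regularTree m).Subgraph} (hT : T.coe.Preconnected)
    (h0 : treeRoot m ∈ T.verts) {u v : TreeVertex m} {a : Fin m} (hu : u ∈ T.verts)
    (huv : u.1 = a :: v.1) : T.Adj u v := by
  obtain ⟨p⟩ := hT ⟨u, hu⟩ ⟨treeRoot m, h0⟩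
  obtain ⟨d, -, h1, h2⟩ := p.exists_boundary_dart {x | u.1 <:+ x.1.1} List.suffix_rfl (by
    simp [treeRoot, huv])
  simp only [Set.mem_ofPred_eq] at h1 h2
  have hd : T.Adj d.fst.1 d.snd.1 := d.adj
  rcases hd.adj_sub with ⟨b, hb⟩ | ⟨b, hb⟩
  · exact absurd (hb ▸ h1.trans (List.suffix_cons b _)) h2
  · rw [hb, List.suffix_cons_iff] at h1
    rcases h1 with h1 | h1
    · rw [← hb] at h1
      have e1 : u = d.fst.1 := Subtype.ext h1
      have e2 : v = d.snd.1 := by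
        apply Subtype.ext
        rw [← h1, huv] at hb
        exact (List.cons.inj hb).2
      rw [e1, e2]
      exact hd
    · exact absurd h1 h2

/-- The word that names a vertex. -/
def word (u : TreeVertex m) : List (Fin m) := u.1

theorem word_injective : Function.Injective (word (m := m)) := fun _ _ h => Subtype.ext h

/-- The vertex named by the tail of the word of `u`. -/
def parent (u : TreeVertex m) : TreeVertex m := ⟨u.1.tail, u.2.tail⟩

/-- The edge from a word to its tail. -/
def parentEdge (u : TreeVertex m) : Sym2 (TreeVertex m) := s(u, parent u)

theorem parentEdge_injOn : Set.InjOn (parentEdge (m := m)) {u | word u ≠ []} := by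
  intro u h1 v h2 h
  simp only [Set.mem_ofPred_eq, ← List.length_pos_iff] at h1 h2
  rw [parentEdge, parentEdge, Sym2.eq_iff] at h
  rcases h with h | ⟨h, h'⟩
  · exact h.1
  · have e1 := congrArg (fun x => (word x).length) h
    have e2 := congrArg (fun x => (word x).length) h'
    simp only [parent, word, List.length_tail] at e1 e2 h1 h2
    omega

theorem edgeSet_eq_image {T : (regularTree m).Subgraph} (hT : T.coe.Preconnected)
    (h0 : treeRoot m ∈ T.verts) : T.edgeSet = parentEdge '' (T.verts \ {treeRoot m}) := by
  have key : ∀ u v : TreeVertex m, T.Adj u v → (∃ a, u.1 = a :: v.1) →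
      s(u, v) ∈ parentEdge '' (T.verts \ {treeRoot m}) := by
    rintro u v huv ⟨a, ha⟩
    refine ⟨u, ⟨huv.fst_mem, fun h => ?_⟩, ?_⟩
    · rw [Set.mem_singleton_iff] at h
      rw [h] at ha
      simp [treeRoot] at ha
    · have : v = parent u := Subtype.ext (by simp [parent, ha])
      rw [parentEdge, ← this]
  ext e
  constructor
  · induction e with
    | h u v =>
      intro h
      rw [SimpleGraph.Subgraph.mem_edgeSet] at h
      rcases h.adj_sub with hb | hb
      · rw [Sym2.eq_swap]
        exact key v u h.symm hb
      · exact key u v h hb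
  · rintro ⟨u, ⟨hu, hu'⟩, rfl⟩
    rw [parentEdge, SimpleGraph.Subgraph.mem_edgeSet]
    have hne : u.1 ≠ [] := fun h => hu' (Subtype.ext h)
    obtain ⟨a, l, h⟩ := List.exists_cons_of_ne_nil hne
    exact adj_of_cons_mem hT h0 (a := a) hu (by simp [parent, h])

theorem subgraph_eq_of_verts_eq {T T' : (regularTree m).Subgraph} (hT : T.coe.Preconnected)
    (hT' : T'.coe.Preconnected) (h0 : treeRoot m ∈ T.verts) (h : T.verts = T'.verts) : T = T' := by
  refine SimpleGraph.Subgraph.ext h ?_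
  have : T.edgeSet = T'.edgeSet := by
    rw [edgeSet_eq_image hT h0, edgeSet_eq_image hT' (h ▸ h0), h]
  ext u v
  rw [← SimpleGraph.Subgraph.mem_edgeSet, this, SimpleGraph.Subgraph.mem_edgeSet]

/-- A connected subgraph through the root is determined by its vertices and has one edge per
non-root vertex. One inequality suffices: the counts enter only as coefficients of nonnegative
terms, in sums that are bounded from above. -/
theorem numSubtrees_le (m k : ℕ) : numSubtrees m k ≤ (rootedTrees m k).card := by
  classical
  rw [numSubtrees, ← Set.ncard_coe_finset]
  have hfin : ∀ T : (regularTree m).Subgraph, treeRoot m ∈ T.verts → T.coe.IsTree →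
      T.edgeSet.encard = k → T.verts.encard = k + 1 := by
    intro T h0 hT hk
    rw [edgeSet_eq_image hT.1.preconnected h0, Set.InjOn.encard_image] at hk
    · rw [← Set.encard_sdiff_singleton_add_one h0, hk]
    · refine parentEdge_injOn.mono fun u hu h => hu.2 (Subtype.ext h)
  have hfin' : ∀ T : (regularTree m).Subgraph, T.verts.encard = k + 1 → T.verts.Finite := by
    intro T h
    refine Set.finite_of_encard_eq_coe (k := k + 1) (by rw [h]; rfl)
  refine Set.ncard_le_ncard_of_injOn
    (fun T => if h : T.verts.Finite then h.toFinset.image word else ∅) ?_ ?_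
    (finite_toSet _)
  · rintro T ⟨h0, hT, hk⟩
    have hc := hfin T h0 hT hk
    have hf := hfin' T hc
    simp only [dif_pos hf, mem_coe, mem_rootedTrees]
    refine ⟨⟨?_, ?_, ?_⟩, ?_⟩
    · exact mem_image.2 ⟨treeRoot m, hf.mem_toFinset.2 h0, rfl⟩
    · intro l hl
      obtain ⟨u, -, rfl⟩ := mem_image.1 hl
      exact u.2
    · intro a l hl
      obtain ⟨u, hu, hu'⟩ := mem_image.1 hl
      have hl' : l.IsChain (· ≠ ·) := by
        have h : (word u).IsChain (· ≠ ·) := u.2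
        rw [hu'] at h
        exact h.tail
      exact mem_image.2 ⟨⟨l, hl'⟩, hf.mem_toFinset.2 (adj_of_cons_mem hT.1.preconnected h0
        (v := ⟨l, hl'⟩) (hf.mem_toFinset.1 hu) hu').snd_mem, rfl⟩
    · rw [card_image_of_injective _ word_injective]
      have := hf.encard_eq_coe_toFinset_card
      rw [hc] at this
      exact_mod_cast this.symm
  · rintro T ⟨h0, hT, hk⟩ T' ⟨h0', hT', hk'⟩ h
    have hf := hfin' T (hfin T h0 hT hk)
    have hf' := hfin' T' (hfin T' h0' hT' hk')
    simp only [dif_pos hf, dif_pos hf'] at h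
    have := image_injective word_injective h
    exact subgraph_eq_of_verts_eq hT.1.preconnected hT'.1.preconnected h0 (Set.Finite.toFinset_inj.1 this)

/-! ### Percolation on the regular tree -/

open Classical in
/-- The children of the words in `W`. -/
noncomputable def children (W : Finset (List (Fin m))) : Finset (List (Fin m)) :=
  W.biUnion fun l => (univ.filter fun a => (a :: l).IsChain (· ≠ ·)).image fun a => a :: l

theorem cons_mem_children {W : Finset (List (Fin m))} {a : Fin m} {l : List (Fin m)} :
    a :: l ∈ children W ↔ l ∈ W ∧ (a :: l).IsChain (· ≠ ·) := by
  simp only [children, mem_biUnion, mem_image, mem_filter, mem_univ, true_and, List.cons.injEq]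
  constructor
  · rintro ⟨l', h1, a', h2, rfl, rfl⟩
    exact ⟨h1, h2⟩
  · rintro ⟨h1, h2⟩
    exact ⟨l, h1, a, h2, rfl, rfl⟩

theorem nil_notMem_children (W : Finset (List (Fin m))) : [] ∉ children W := by
  simp [children]

theorem card_children_le {W : Finset (List (Fin m))} {k : ℕ} (hW : IsRootedTree W)
    (hk : W.card = k + 1) : (children W).card ≤ m + (m - 1) * k := by
  classical
  rw [children, ← insert_erase hW.nil_mem]
  refine card_biUnion_le.trans ?_
  rw [sum_insert (notMem_erase _ _)]
  refine add_le_add ?_ ?_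
  · exact card_image_le.trans ((card_le_univ _).trans (by simp))
  · have hk' : (W.erase []).card = k := by rw [card_erase_of_mem hW.nil_mem, hk]; rfl
    rw [mul_comm, ← hk', ← smul_eq_mul]
    refine sum_le_card_nsmul _ _ _ fun l hl => card_image_le.trans ?_
    obtain ⟨b, l, rfl⟩ := List.exists_cons_of_ne_nil (mem_erase.1 hl).1
    have : (univ.filter fun a => (a :: b :: l).IsChain (· ≠ ·)) ⊆ univ.erase b := by
      intro a ha
      simp only [mem_filter, List.isChain_cons_cons] at ha
      exact mem_erase.2 ⟨ha.2.1, mem_univ _⟩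
    exact (card_le_card this).trans (by simp)

theorem erase_nil_subset_children {W : Finset (List (Fin m))} (hW : IsRootedTree W) :
    W.erase [] ⊆ children W := by
  intro l hl
  rw [mem_erase] at hl
  obtain ⟨b, l, rfl⟩ := List.exists_cons_of_ne_nil hl.1
  exact cons_mem_children.2 ⟨hW.of_cons _ _ hl.2, hW.isChain _ hl.2⟩

/-- A nonempty word stands for the edge to its tail. If the edges leaving W are closed and those of
W' are open, W' cannot grow out of W; hence distinct trees are clusters of the root in disjoint
events. -/
theorem subset_of_cylinder {W W' A : Finset (List (Fin m))} (hW : IsRootedTree W)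
    (hW' : IsRootedTree W') (h : Disjoint (children W \ W) A) (h' : W'.erase [] ⊆ A) :
    W' ⊆ W := by
  intro l
  induction l with
  | nil => exact fun _ => hW.nil_mem
  | cons a l ih =>
    intro hl
    by_contra hl2
    have h1 : a :: l ∈ children W :=
      cons_mem_children.2 ⟨ih (hW'.of_cons _ _ hl), hW'.isChain _ hl⟩
    exact disjoint_left.1 h (mem_sdiff.2 ⟨h1, hl2⟩) (h' (mem_erase.2 ⟨by simp, hl⟩))

/-- The probabilities that the cluster of the root is a given tree with less than `N` edges add
up to at most `1`. -/
theorem sum_card_rootedTrees_le (hm : 2 ≤ m) (N : ℕ) {x : ℝ} (h0 : 0 ≤ x) (h1 : x ≤ 1) :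
    ∑ k ∈ range N, ((rootedTrees m k).card : ℝ) * (x ^ k * (1 - x) ^ (m + (m - 2) * k)) ≤ 1 := by
  classical
  set R := (range N).biUnion (rootedTrees m) with hR
  have hR' : ∀ W ∈ R, IsRootedTree W ∧ W.card ≤ N := by
    intro W hW
    obtain ⟨k, hk, hW⟩ := mem_biUnion.1 hW
    rw [mem_rootedTrees] at hW
    rw [mem_range] at hk
    exact ⟨hW.1, by omega⟩
  set ev : Finset (List (Fin m)) → Finset (List (Fin m)) → ℝ := fun W A =>
    if W.erase [] ⊆ A ∧ Disjoint (children W \ W) A then 1 else 0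
  have hpt : ∀ A : Finset (List (Fin m)), ∑ W ∈ R, ev W A ≤ 1 := by
    intro A
    rw [← sum_filter, sum_const, nsmul_one]
    have : (R.filter fun W => W.erase [] ⊆ A ∧ Disjoint (children W \ W) A).card ≤ 1 := by
      refine card_le_one.2 fun W hW W' hW' => ?_
      simp only [mem_filter] at hW hW'
      have t := (hR' W hW.1).1
      have t' := (hR' W' hW'.1).1
      exact Subset.antisymm (subset_of_cylinder t' t hW'.2.2 hW.2.1)
        (subset_of_cylinder t t' hW.2.2 hW'.2.1)
    exact_mod_cast this
  -- Length N is enough: a tree with k < N edges has words of length at most k, and its children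
  -- have length at most k + 1.
  have hE := eval_expectation_mono (s := words m N) h0 h1 fun A _ => hpt A
  rw [expectation_const, Polynomial.eval_C, expectation_sum, Polynomial.eval_finsetSum, hR,
    sum_biUnion (rootedTrees_pairwiseDisjoint m _)] at hE
  refine le_trans (sum_le_sum fun k hk => ?_) hE
  rw [← nsmul_eq_mul]
  refine card_nsmul_le_sum _ _ _ fun W hW => ?_
  rw [mem_rootedTrees] at hW
  obtain ⟨hW, hWk⟩ := hW
  rw [mem_range] at hk
  have hsub : ∀ l ∈ children W, l.length ≤ N := by
    intro l hl
    cases l with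
    | nil => exact absurd hl (nil_notMem_children W)
    | cons a l =>
      have := hW.length_lt (cons_mem_children.1 hl).1
      rw [List.length_cons]
      omega
  have hI := erase_nil_subset_children hW
  have hcI : (W.erase []).card = k := by rw [card_erase_of_mem hW.nil_mem, hWk]; rfl
  have hJ : children W \ W = children W \ W.erase [] := by
    ext l
    simp only [mem_sdiff, mem_erase]
    have := nil_notMem_children W
    grind
  rw [eval_expectation_cylinder _ _ _ (fun l hl => mem_words.2 (hsub l (hI hl)))
    (fun l hl => mem_words.2 (hsub l (mem_sdiff.1 hl).1))
    (disjoint_left.2 fun l hl hl' => (mem_sdiff.1 hl').2 (mem_erase.1 hl).2), hcI]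
  refine mul_le_mul_of_nonneg_left (pow_le_pow_of_le_one (by linarith) (by linarith) ?_)
    (pow_nonneg h0 _)
  rw [hJ, card_sdiff_of_subset hI, hcI]
  have := card_children_le hW hWk
  obtain ⟨d, rfl⟩ := Nat.exists_eq_add_of_le hm
  rw [show 2 + d - 1 = d + 1 by omega] at this
  rw [show 2 + d - 2 = d by omega]
  have e : (d + 1) * k = d * k + k := by ring
  omega

end RegularTree

namespace RegularTree

open Finset Percolation

/-! ### Covering a regular graph by the tree, injectively below the girth -/

section Cover

variable {V : Type*} {G : SimpleGraph V} {m : ℕ}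

/-- The covering map from words to the vertices of an `m`-regular graph whose neighbourhoods are
labelled by `ε`. Together with the image of a word it gives a labelling of the neighbours of this
image, under which the first letter of the word leads back to the image of its tail. -/
def cover (ε : ∀ v, Fin m ≃ G.neighborSet v) (v₀ : V) :
    List (Fin m) → Σ v, Fin m ≃ G.neighborSet v
  | [] => ⟨v₀, ε v₀⟩
  | a :: l =>
    let s := cover ε v₀ l
    ⟨s.2 a, (Equiv.swap a ((ε (s.2 a)).symm ⟨s.1, (s.2 a).2.symm⟩)).trans (ε (s.2 a))⟩

variable (ε : ∀ v, Fin m ≃ G.neighborSet v) (v₀ : V)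

theorem cover_cons (a : Fin m) (l : List (Fin m)) :
    (cover ε v₀ (a :: l)).1 = (cover ε v₀ l).2 a := rfl

theorem cover_adj (a : Fin m) (l : List (Fin m)) :
    G.Adj (cover ε v₀ (a :: l)).1 (cover ε v₀ l).1 := by
  rw [cover_cons]
  exact ((cover ε v₀ l).2 a).2.symm

theorem cover_label_self (a : Fin m) (l : List (Fin m)) :
    ((cover ε v₀ (a :: l)).2 a : V) = (cover ε v₀ l).1 := by
  change (ε _ (Equiv.swap a _ a) : V) = _
  rw [Equiv.swap_apply_left, Equiv.apply_symm_apply]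

theorem cover_cons_injective (l : List (Fin m)) :
    Function.Injective fun a => (cover ε v₀ (a :: l)).1 := fun _ _ h =>
  (cover ε v₀ l).2.injective (Subtype.ext h)

/-- The swap in `cover` makes the letter a lead back, so words without repeated consecutive letters
trace walks without backtracking. -/
theorem eq_of_cover_cons_cons {a b : Fin m} {l : List (Fin m)}
    (h : (cover ε v₀ (b :: a :: l)).1 = (cover ε v₀ l).1) : b = a := by
  rw [cover_cons, ← cover_label_self ε v₀ a l] at h
  exact (cover ε v₀ (a :: l)).2.injective (Subtype.ext h)

theorem eq_of_map_tails_eq {l l' : List (Fin m)}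
    (h : l.tails.map (fun x => (cover ε v₀ x).1) = l'.tails.map fun x => (cover ε v₀ x).1) :
    l = l' := by
  induction l generalizing l' with
  | nil =>
    cases l' with
    | nil => rfl
    | cons b l' => have := congrArg List.length h; simp at this
  | cons a l ih =>
    cases l' with
    | nil => have := congrArg List.length h; simp at this
    | cons b l' =>
      simp only [List.tails_cons, List.map_cons, List.cons.injEq] at h
      obtain rfl := ih h.2
      rw [cover_cons_injective ε v₀ l h.1]

/-- The graph on all the vertices whose edges are the edges of `G` inside `X`. -/
def restrict (G : SimpleGraph V) (X : Finset V) : SimpleGraph V where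
  Adj u v := G.Adj u v ∧ u ∈ X ∧ v ∈ X
  symm := ⟨fun _ _ h => ⟨h.1.symm, h.2.2, h.2.1⟩⟩
  loopless := ⟨fun _ h => h.1.ne rfl⟩

theorem restrict_isAcyclic {X : Finset V} (hX : (X.card : ℕ∞) < G.egirth) :
    (restrict G X).IsAcyclic := by
  intro v p hp
  have hle : restrict G X ≤ G := fun _ _ h => h.1
  have h1 := SimpleGraph.egirth_le_length (hp.mapLe hle)
  rw [SimpleGraph.Walk.length_mapLe] at h1
  classical
  have h2 : p.support.tail.toFinset ⊆ X := by
    intro u hu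
    rw [List.mem_toFinset, ← SimpleGraph.Walk.map_snd_darts, List.mem_map] at hu
    obtain ⟨d, -, rfl⟩ := hu
    exact d.adj.2.2
  have h3 := card_le_card h2
  rw [List.toFinset_card_of_nodup hp.support_nodup, List.length_tail,
    SimpleGraph.Walk.length_support, Nat.add_sub_cancel] at h3
  exact absurd (hX.trans_le h1) (not_lt.2 (by exact_mod_cast h3))

/-- The edges of the image of the path from a word to the root. -/
def pathEdges : List (Fin m) → List (Sym2 V)
  | [] => []
  | a :: l => s((cover ε v₀ (a :: l)).1, (cover ε v₀ l).1) :: pathEdges l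

theorem pathEdges_isChain {l : List (Fin m)} (hl : l.IsChain (· ≠ ·)) :
    (pathEdges ε v₀ l).IsChain (· ≠ ·) := by
  induction l with
  | nil => exact List.IsChain.nil
  | cons a l ih =>
    cases l with
    | nil => exact List.IsChain.singleton _
    | cons b l =>
      rw [List.isChain_cons_cons] at hl
      refine List.IsChain.cons_cons (fun h => ?_) (ih hl.2)
      rcases Sym2.eq_iff.1 h with h | h
      · exact (cover_adj ε v₀ a (b :: l)).ne h.1
      · exact hl.1 (eq_of_cover_cons_cons ε v₀ h.1)

theorem exists_walk {W : Finset (List (Fin m))} (hW : IsRootedTree W) {X : Finset V}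
    (hX : ∀ l ∈ W, (cover ε v₀ l).1 ∈ X) {l : List (Fin m)} (hl : l ∈ W) :
    ∃ p : (restrict G X).Walk (cover ε v₀ l).1 v₀,
      p.support = (l.tails.map fun x => (cover ε v₀ x).1) ∧ p.edges = pathEdges ε v₀ l := by
  induction l with
  | nil => exact ⟨SimpleGraph.Walk.nil, rfl, rfl⟩
  | cons a l ih =>
    have hl' := hW.of_cons a l hl
    obtain ⟨p, h1, h2⟩ := ih hl'
    have hadj : (restrict G X).Adj (cover ε v₀ (a :: l)).1 (cover ε v₀ l).1 :=
      ⟨cover_adj ε v₀ a l, hX _ hl, hX _ hl'⟩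
    refine ⟨SimpleGraph.Walk.cons hadj p, ?_, ?_⟩
    · rw [SimpleGraph.Walk.support_cons, h1]
      rfl
    · rw [SimpleGraph.Walk.edges_cons, h2]
      rfl

theorem exists_path {W : Finset (List (Fin m))} (hW : IsRootedTree W) {X : Finset V}
    (hX : ∀ l ∈ W, (cover ε v₀ l).1 ∈ X) (hcard : (X.card : ℕ∞) < G.egirth)
    {l : List (Fin m)} (hl : l ∈ W) {x : V} (hx : x = (cover ε v₀ l).1) :
    ∃ p : (restrict G X).Path x v₀,
      p.1.support = (l.tails.map fun x => (cover ε v₀ x).1) := by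
  subst hx
  obtain ⟨p, h1, h2⟩ := exists_walk ε v₀ hW hX hl
  refine ⟨⟨p, ((restrict_isAcyclic hcard).isPath_iff_isChain p).2 ?_⟩, h1⟩
  rw [h2]
  exact pathEdges_isChain ε v₀ (hW.isChain l hl)

/-- Within a set of fewer vertices than the girth, the covering map is injective. -/
theorem eq_of_cover_eq {W W' : Finset (List (Fin m))} (hW : IsRootedTree W)
    (hW' : IsRootedTree W') {X : Finset V} (hX : ∀ l ∈ W, (cover ε v₀ l).1 ∈ X)
    (hX' : ∀ l ∈ W', (cover ε v₀ l).1 ∈ X) (hcard : (X.card : ℕ∞) < G.egirth)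
    {l l' : List (Fin m)} (hl : l ∈ W) (hl' : l' ∈ W')
    (h : (cover ε v₀ l).1 = (cover ε v₀ l').1) : l = l' := by
  obtain ⟨p, hp⟩ := exists_path ε v₀ hW hX hcard hl rfl
  obtain ⟨q, hq⟩ := exists_path ε v₀ hW' hX' hcard hl' h
  -- X has too few vertices to contain a cycle, so the walks traced by the two words are paths,
  -- hence equal; the list of visited vertices determines the word.
  obtain rfl := ((restrict_isAcyclic hcard).subsingleton_path _ _).elim p q
  exact eq_of_map_tails_eq ε v₀ (hp.symm.trans hq)

variable [DecidableEq V]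

/-- The image of a rooted tree. -/
def coverImage (W : Finset (List (Fin m))) : Finset V := W.image fun l => (cover ε v₀ l).1

theorem card_coverImage_le (W : Finset (List (Fin m))) : (coverImage ε v₀ W).card ≤ W.card :=
  card_image_le

theorem mem_coverImage {W : Finset (List (Fin m))} {l : List (Fin m)} (hl : l ∈ W) :
    (cover ε v₀ l).1 ∈ coverImage ε v₀ W := mem_image_of_mem _ hl

theorem cover_injOn {W : Finset (List (Fin m))} (hW : IsRootedTree W)
    (hcard : (W.card : ℕ∞) < G.egirth) : Set.InjOn (fun l => (cover ε v₀ l).1) W :=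
  fun _ hl _ hl' h => eq_of_cover_eq ε v₀ hW hW (fun _ => mem_coverImage ε v₀)
    (fun _ => mem_coverImage ε v₀)
    (lt_of_le_of_lt (by exact_mod_cast card_coverImage_le ε v₀ W) hcard) hl hl' h

theorem card_coverImage {W : Finset (List (Fin m))} (hW : IsRootedTree W)
    (hcard : (W.card : ℕ∞) < G.egirth) : (coverImage ε v₀ W).card = W.card :=
  card_image_of_injOn (cover_injOn ε v₀ hW hcard)

theorem eq_of_coverImage_eq {W W' : Finset (List (Fin m))} (hW : IsRootedTree W)
    (hW' : IsRootedTree W') (hcard : (W.card : ℕ∞) < G.egirth)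
    (h : coverImage ε v₀ W = coverImage ε v₀ W') : W = W' := by
  have hc : ((coverImage ε v₀ W).card : ℕ∞) < G.egirth :=
    lt_of_le_of_lt (by exact_mod_cast card_coverImage_le ε v₀ W) hcard
  have h1 : ∀ l ∈ W, (cover ε v₀ l).1 ∈ coverImage ε v₀ W := fun _ => mem_coverImage ε v₀
  have h2 : ∀ l ∈ W', (cover ε v₀ l).1 ∈ coverImage ε v₀ W := fun _ hl =>
    h ▸ mem_coverImage ε v₀ hl
  ext l
  constructor
  · intro hl
    obtain ⟨l', hl', e⟩ := mem_image.1 (h ▸ mem_coverImage ε v₀ hl : _ ∈ coverImage ε v₀ W')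
    rwa [eq_of_cover_eq ε v₀ hW hW' h1 h2 hc hl hl' e.symm]
  · intro hl
    obtain ⟨l', hl', e⟩ := mem_image.1 (h2 l hl)
    rwa [eq_of_cover_eq ε v₀ hW' hW h2 h1 hc hl hl' e.symm]

/-- The edge between the images of a word and of its tail. -/
def coverEdge (l : List (Fin m)) : Sym2 V := s((cover ε v₀ l).1, (cover ε v₀ l.tail).1)

/-- The edges of the image of a rooted tree. -/
def treeEdges (W : Finset (List (Fin m))) : Finset (Sym2 V) :=
  (W.erase []).image (coverEdge ε v₀)

theorem card_treeEdges {W : Finset (List (Fin m))} (hW : IsRootedTree W)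
    (hcard : (W.card : ℕ∞) < G.egirth) : (treeEdges ε v₀ W).card + 1 = W.card := by
  rw [treeEdges, card_image_of_injOn, card_erase_add_one hW.nil_mem]
  intro l hl l' hl' h
  have hi := cover_injOn ε v₀ hW hcard
  rw [mem_coe, mem_erase] at hl hl'
  obtain ⟨a, l, rfl⟩ := List.exists_cons_of_ne_nil hl.1
  obtain ⟨b, l', rfl⟩ := List.exists_cons_of_ne_nil hl'.1
  rcases Sym2.eq_iff.1 h with h | ⟨h1, h2⟩
  · exact hi hl.2 hl'.2 h.1
  · have e1 := congrArg List.length (hi hl.2 (hW.of_cons _ _ hl'.2) h1)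
    have e2 := congrArg List.length (hi (hW.of_cons _ _ hl.2) hl'.2 h2)
    simp only [List.length_cons] at e1 e2
    omega

theorem mem_treeEdges {W : Finset (List (Fin m))} {e : Sym2 V} (he : e ∈ treeEdges ε v₀ W) :
    ∃ a l, a :: l ∈ W ∧ e = s((cover ε v₀ (a :: l)).1, (cover ε v₀ l).1) := by
  obtain ⟨l, hl, rfl⟩ := mem_image.1 he
  rw [mem_erase] at hl
  obtain ⟨a, l, rfl⟩ := List.exists_cons_of_ne_nil hl.1
  exact ⟨a, l, hl.2, rfl⟩

end Cover

/-! ### Small clusters and the expected inverse cluster size -/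

section Clusters

variable {V : Type*} [Fintype V] [DecidableEq V] {G : SimpleGraph V} [DecidableRel G.Adj] {m : ℕ}
  (ε : ∀ v, Fin m ≃ G.neighborSet v) (v₀ : V)

/-- The edges with at least one end in `X`. -/
def touching (G : SimpleGraph V) [DecidableRel G.Adj] (X : Finset V) : Finset (Sym2 V) :=
  X.biUnion fun v => G.incidenceFinset v

theorem mem_touching {X : Finset V} {e : Sym2 V} :
    e ∈ touching G X ↔ e ∈ G.edgeSet ∧ ∃ v ∈ X, v ∈ e := by
  simp only [touching, mem_biUnion, SimpleGraph.mem_incidenceFinset, SimpleGraph.incidenceSet,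
    Set.mem_ofPred_eq]
  tauto

theorem treeEdges_subset {W : Finset (List (Fin m))} :
    treeEdges ε v₀ W ⊆ touching G (coverImage ε v₀ W) := by
  intro e he
  obtain ⟨a, l, h, rfl⟩ := mem_treeEdges ε v₀ he
  exact mem_touching.2 ⟨cover_adj ε v₀ a l, _, mem_coverImage ε v₀ h, by simp⟩

/-- The degrees over the image add up to m(k + 1); this counts each of the k tree edges twice and
every other touching edge at least once. -/
theorem card_touching_le (hG : ∀ v, G.degree v = m) {W : Finset (List (Fin m))} {k : ℕ}
    (hW : IsRootedTree W) (hk : W.card = k + 1) (hcard : (W.card : ℕ∞) < G.egirth) :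
    (touching G (coverImage ε v₀ W) \ treeEdges ε v₀ W).card + 2 * k ≤ m * (k + 1) := by
  set X := coverImage ε v₀ W with hX
  have h1 := sum_card_bipartiteAbove_eq_sum_card_bipartiteBelow (s := X) (t := touching G X)
    (fun v e => v ∈ e)
  have h2 : ∑ v ∈ X, (bipartiteAbove (fun v e => v ∈ e) (touching G X) v).card = m * (k + 1) := by
    rw [← hk, ← card_coverImage ε v₀ hW hcard, ← hX, mul_comm, ← smul_eq_mul]
    refine sum_const_nat fun v hv => ?_
    rw [← hG v, ← SimpleGraph.card_incidenceFinset_eq_degree]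
    congr 1
    ext e
    rw [mem_bipartiteAbove, mem_touching, SimpleGraph.mem_incidenceFinset]
    exact ⟨fun h => ⟨h.1.1, h.2⟩, fun h => ⟨⟨h.1, v, hv, h.2⟩, h.2⟩⟩
  have hI := card_treeEdges ε v₀ hW hcard
  rw [h2, ← sdiff_union_of_subset (treeEdges_subset ε v₀), sum_union sdiff_disjoint] at h1
  rw [h1]
  refine add_le_add ?_ ?_
  · rw [card_eq_sum_ones]
    refine sum_le_sum fun e he => card_pos.2 ?_
    obtain ⟨-, v, hv, hve⟩ := mem_touching.1 (mem_sdiff.1 he).1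
    exact ⟨v, (mem_bipartiteBelow _).2 ⟨hv, hve⟩⟩
  · have : (treeEdges ε v₀ W).card = k := by omega
    rw [← this, mul_comm, ← smul_eq_mul]
    refine card_nsmul_le_sum _ _ _ fun e he => ?_
    obtain ⟨a, l, h, rfl⟩ := mem_treeEdges ε v₀ he
    refine one_lt_card.2 ⟨(cover ε v₀ (a :: l)).1, ?_, (cover ε v₀ l).1, ?_,
      (cover_adj ε v₀ a l).ne⟩
    · exact (mem_bipartiteBelow _).2 ⟨mem_coverImage ε v₀ h, by simp⟩
    · exact (mem_bipartiteBelow _).2 ⟨mem_coverImage ε v₀ (hW.of_cons _ _ h), by simp⟩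

/-- The set of vertices connected to `v` by edges in `A`. -/
noncomputable def cluster (A : Finset (Sym2 V)) (v : V) : Finset V :=
  open Classical in
  univ.filter fun u => (SimpleGraph.fromEdgeSet (A : Set (Sym2 V))).Reachable v u

theorem mem_cluster {A : Finset (Sym2 V)} {v u : V} :
    u ∈ cluster A v ↔ (SimpleGraph.fromEdgeSet (A : Set (Sym2 V))).Reachable v u := by
  simp [cluster]

/-- An open edge leaving the image would touch it without being a tree edge, and these edges are
closed; the open tree edges connect the image. -/
theorem cluster_eq_coverImage {W : Finset (List (Fin m))} {A : Finset (Sym2 V)}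
    (hA : A ⊆ G.edgeFinset) (hW : IsRootedTree W) (h1 : treeEdges ε v₀ W ⊆ A)
    (h2 : Disjoint (touching G (coverImage ε v₀ W) \ treeEdges ε v₀ W) A) :
    cluster A v₀ = coverImage ε v₀ W := by
  ext u
  rw [mem_cluster]
  constructor
  · rintro ⟨p⟩
    by_contra hu
    obtain ⟨d, -, h3, h4⟩ := p.exists_boundary_dart (coverImage ε v₀ W : Set V)
      (mem_coverImage ε v₀ hW.nil_mem) hu
    have hd := (SimpleGraph.fromEdgeSet_adj _).1 d.adj
    have hd' : s(d.fst, d.snd) ∈ A := hd.1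
    have h5 : s(d.fst, d.snd) ∈ touching G (coverImage ε v₀ W) :=
      mem_touching.2 ⟨SimpleGraph.mem_edgeFinset.1 (hA hd'), d.fst, h3, by simp⟩
    by_cases h6 : s(d.fst, d.snd) ∈ treeEdges ε v₀ W
    · obtain ⟨a, l, h, e⟩ := mem_treeEdges ε v₀ h6
      refine h4 ?_
      have hm : d.snd ∈ s((cover ε v₀ (a :: l)).1, (cover ε v₀ l).1) := by rw [← e]; simp
      rcases Sym2.mem_iff.1 hm with e | e
      · rw [e]; exact mem_coverImage ε v₀ h
      · rw [e]; exact mem_coverImage ε v₀ (hW.of_cons _ _ h)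
    · exact disjoint_left.1 h2 (mem_sdiff.2 ⟨h5, h6⟩) hd'
  · intro hu
    obtain ⟨l, hl, rfl⟩ := mem_image.1 hu
    clear hu
    induction l with
    | nil => exact SimpleGraph.Reachable.refl _
    | cons a l ih =>
      refine (ih (hW.of_cons _ _ hl)).trans (SimpleGraph.Adj.reachable ?_)
      rw [SimpleGraph.fromEdgeSet_adj]
      refine ⟨?_, (cover_adj ε v₀ a l).ne.symm⟩
      rw [Sym2.eq_swap]
      exact h1 (mem_image.2 ⟨a :: l, mem_erase.2 ⟨by simp, hl⟩, rfl⟩)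

/-- Lower bound for the expectation of the inverse of the size of the cluster of a vertex. -/
theorem sum_rootedTrees_le_expectation_inv_card_cluster (hG : ∀ v, G.degree v = m)
    (hm : 2 ≤ m) {N : ℕ} (hN : (N : ℕ∞) < G.egirth) (v₀ : V) {p : ℝ} (h0 : 0 ≤ p) (h1 : p ≤ 1) :
    ∑ k ∈ range N, ((rootedTrees m k).card : ℝ) / (k + 1) * (p ^ k * (1 - p) ^ (m + (m - 2) * k)) ≤
      (expectation G.edgeFinset fun A => ((cluster A v₀).card : ℝ)⁻¹).eval p := by
  classical
  have ε : ∀ v, Fin m ≃ G.neighborSet v := fun v =>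
    (Fintype.equivFinOfCardEq (by rw [SimpleGraph.card_neighborSet_eq_degree, hG])).symm
  set R := (range N).biUnion (rootedTrees m) with hR
  have hR' : ∀ W ∈ R, IsRootedTree W ∧ (W.card : ℕ∞) < G.egirth := by
    intro W hW
    obtain ⟨k, hk, hW⟩ := mem_biUnion.1 hW
    rw [mem_rootedTrees] at hW
    rw [mem_range] at hk
    refine ⟨hW.1, lt_of_le_of_lt ?_ hN⟩
    rw [hW.2]
    exact_mod_cast hk
  set ev : Finset (List (Fin m)) → Finset (Sym2 V) → Prop := fun W A =>
    treeEdges ε v₀ W ⊆ A ∧ Disjoint (touching G (coverImage ε v₀ W) \ treeEdges ε v₀ W) A with hev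
  -- At most one event occurs, since the cluster determines W; when it does, the cluster has as many
  -- vertices as W.
  have hpt : ∀ A ⊆ G.edgeFinset, ∑ W ∈ R, (W.card : ℝ)⁻¹ * (if ev W A then 1 else 0) ≤
      ((cluster A v₀).card : ℝ)⁻¹ := by
    intro A hA
    by_cases hex : ∃ W ∈ R, ev W A
    · obtain ⟨W, hWR, hW⟩ := hex
      obtain ⟨t, tc⟩ := hR' W hWR
      have e := cluster_eq_coverImage ε v₀ hA t hW.1 hW.2
      rw [sum_eq_single_of_mem W hWR, if_pos hW, mul_one, e, card_coverImage ε v₀ t tc]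
      intro W' hW'R hne
      rw [if_neg, mul_zero]
      intro hW'
      refine hne (eq_of_coverImage_eq ε v₀ (hR' W' hW'R).1 t (hR' W' hW'R).2 ?_)
      rw [← e, cluster_eq_coverImage ε v₀ hA (hR' W' hW'R).1 hW'.1 hW'.2]
    · rw [sum_eq_zero]
      · positivity
      · intro W hW
        rw [if_neg fun h => hex ⟨W, hW, h⟩, mul_zero]
  have hE := eval_expectation_mono h0 h1 hpt
  rw [expectation_sum, Polynomial.eval_finsetSum, hR,
    sum_biUnion (rootedTrees_pairwiseDisjoint m _)] at hE
  refine le_trans (sum_le_sum fun k hk => ?_) hE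
  rw [div_mul_eq_mul_div, mul_div_assoc, ← nsmul_eq_mul]
  refine card_nsmul_le_sum _ _ _ fun W hW => ?_
  obtain ⟨t, tc⟩ := hR' W (mem_biUnion.2 ⟨k, hk, hW⟩)
  have hWk := (mem_rootedTrees.1 hW).2
  have hcI : (treeEdges ε v₀ W).card = k := by
    have := card_treeEdges ε v₀ t tc
    omega
  have htouch : touching G (coverImage ε v₀ W) ⊆ G.edgeFinset := fun e he =>
    SimpleGraph.mem_edgeFinset.2 (mem_touching.1 he).1
  have hJ := card_touching_le ε v₀ hG t hWk tc
  rw [expectation_const_mul, Polynomial.eval_mul, Polynomial.eval_C,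
    eval_expectation_cylinder _ _ _ ((treeEdges_subset ε v₀).trans htouch)
      (sdiff_subset.trans htouch) disjoint_sdiff, hcI, hWk, div_eq_inv_mul]
  push_cast
  refine mul_le_mul_of_nonneg_left (mul_le_mul_of_nonneg_left
    (pow_le_pow_of_le_one (by linarith) (by linarith) ?_) (pow_nonneg h0 _)) (by positivity)
  obtain ⟨d, rfl⟩ := Nat.exists_eq_add_of_le hm
  rw [show 2 + d - 2 = d by omega]
  have e : (2 + d) * (k + 1) = 2 * k + d * k + 2 + d := by ring
  omega

/-- The vertices of a component of size c contribute c · (1/c) = 1. -/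
theorem sum_inv_card_cluster (A : Finset (Sym2 V)) :
    ∑ v, ((cluster A v).card : ℝ)⁻¹ =
      Nat.card (SimpleGraph.fromEdgeSet (A : Set (Sym2 V))).ConnectedComponent := by
  classical
  set H := SimpleGraph.fromEdgeSet (A : Set (Sym2 V))
  have := Fintype.ofFinite H.ConnectedComponent
  rw [Nat.card_eq_fintype_card, ← card_univ, card_eq_sum_ones, Nat.cast_sum,
    ← sum_fiberwise_of_maps_to (t := univ) (g := H.connectedComponentMk) fun _ _ => mem_univ _]
  refine sum_congr rfl fun c _ => ?_
  have hc : ∀ v ∈ univ.filter fun v => H.connectedComponentMk v = c,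
      ((cluster A v).card : ℝ)⁻¹ = ((univ.filter fun v => H.connectedComponentMk v = c).card : ℝ)⁻¹ := by
    intro v hv
    congr 3
    ext u
    rw [mem_filter] at hv ⊢
    rw [mem_cluster, ← hv.2, SimpleGraph.ConnectedComponent.eq]
    simp [SimpleGraph.reachable_comm, H]
  rw [sum_congr rfl hc, sum_const, nsmul_eq_mul, Nat.cast_one, mul_inv_cancel₀]
  rw [Nat.cast_ne_zero, ← Nat.pos_iff_ne_zero, card_pos]
  obtain ⟨v, hv⟩ := c.exists_rep
  exact ⟨v, mem_filter.2 ⟨mem_univ _, hv⟩⟩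

end Clusters

end RegularTree

namespace Percolation

open Finset

theorem expectation_map {α β : Type*} [DecidableEq α] [DecidableEq β] (s : Finset α) (φ : α ↪ β)
    (f : Finset β → ℝ) : expectation (s.map φ) f = expectation s fun A => f (A.map φ) := by
  induction s using Finset.induction_on generalizing f with
  | empty => simp [expectation]
  | insert i s hi ih =>
    rw [map_insert, expectation_insert (by simpa using hi), expectation_insert hi, ih, ih]
    simp only [map_insert]

theorem eval_one_expectation {α : Type*} [DecidableEq α] (s : Finset α) (f : Finset α → ℝ) :
    (expectation s f).eval 1 = f s := by
  induction s using Finset.induction_on generalizing f with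
  | empty => simp [expectation]
  | insert i s hi ih =>
    rw [expectation_insert hi]
    simp [ih]

end Percolation

/-! ### Expected rank of an incidence matrix -/

section TypeTwo

open Finset Percolation RegularTree

variable {m r n : ℕ} {H : Matrix (Fin r) (Fin n) (ZMod 2)}

theorem ZMod.ne_zero_iff_eq_one (x : ZMod 2) : x ≠ 0 ↔ x = 1 := by
  revert x; decide

theorem ZMod.eq_of_eq_one_iff {x y : ZMod 2} (h : x = 1 ↔ y = 1) : x = y := by
  revert x y; decide

/-- Every column joins two vertices. -/
theorem IsTypeTwo.exists_ends (hH : IsTypeTwo m H) :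
    ∃ ends : Fin n → Sym2 (Fin r), (∀ i j, H i j = 1 ↔ i ∈ ends j) ∧ ∀ j, ¬ (ends j).IsDiag := by
  have : ∀ j, ∃ e : Sym2 (Fin r), (∀ i, H i j = 1 ↔ i ∈ e) ∧ ¬ e.IsDiag := by
    intro j
    obtain ⟨a, b, hab, h⟩ := card_eq_two.1 (hH.2 j)
    refine ⟨s(a, b), fun i => ?_, by simpa using hab⟩
    have := congrArg (i ∈ ·) h
    simp only [mem_filter, mem_univ, true_and, mem_insert, mem_singleton, eq_iff_iff,
      ZMod.ne_zero_iff_eq_one] at this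
    rw [this, Sym2.mem_iff]
  choose e he using this
  exact ⟨e, fun i j => (he j).1 i, fun j => (he j).2⟩

section Ends

variable {ends : Fin n → Sym2 (Fin r)} (h1 : ∀ i j, H i j = 1 ↔ i ∈ ends j)
  (h2 : ∀ j, ¬ (ends j).IsDiag)

include h1

theorem ends_injective (hinj : Function.Injective fun j i => H i j) :
    Function.Injective ends := by
  intro j j' h
  refine hinj (funext fun i => ZMod.eq_of_eq_one_iff ?_)
  rw [h1, h1, h]

include h2

theorem incidenceGraph_edgeSet : (incidenceGraph H).edgeSet = Set.range ends := by
  ext e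
  induction e with
  | h u v =>
    rw [SimpleGraph.mem_edgeSet]
    constructor
    · rintro ⟨hne, j, hu, hv⟩
      rw [h1] at hu hv
      exact ⟨j, (Sym2.mem_and_mem_iff hne).1 ⟨hu, hv⟩⟩
    · rintro ⟨j, hj⟩
      refine ⟨fun h => h2 j (by rw [hj, h]; simp), j, ?_, ?_⟩ <;> rw [h1, hj] <;> simp

/-- A vector constant on components is orthogonal over 𝔽₂ to each column of A, whose two ones lie in
one component. So the left kernel has dimension at least the number of components. -/
theorem colRank_add_card_connectedComponent_le (A : Finset (Fin n)) :
    H.colRank A + Nat.card (SimpleGraph.fromEdgeSet (ends '' A)).ConnectedComponent ≤ r := by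
  set G := SimpleGraph.fromEdgeSet (ends '' A)
  have := Fintype.ofFinite G.ConnectedComponent
  set M := (H.submatrix id (Subtype.val : A → Fin n)).transpose
  have e1 := LinearMap.finrank_range_add_finrank_ker M.mulVecLin
  rw [Module.finrank_fintype_fun_eq_card, Fintype.card_fin] at e1
  have e2 : H.colRank A = Module.finrank (ZMod 2) (LinearMap.range M.mulVecLin) :=
    (Matrix.rank_transpose _).symm
  set Φ := LinearMap.funLeft (ZMod 2) (ZMod 2) G.connectedComponentMk
  have hΦ : Function.Injective Φ :=
    LinearMap.funLeft_injective_of_surjective _ _ _ fun c => c.exists_rep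
  have e3 : LinearMap.range Φ ≤ LinearMap.ker M.mulVecLin := by
    rintro _ ⟨y, rfl⟩
    rw [LinearMap.mem_ker]
    ext j
    obtain ⟨a, b, hab⟩ : ∃ a b, ends j = s(a, b) := by
      induction h : ends j with
      | h a b => exact ⟨a, b, rfl⟩
    have hne : a ≠ b := fun h => h2 j (by rw [hab, h]; simp)
    have hadj : G.connectedComponentMk a = G.connectedComponentMk b :=
      SimpleGraph.ConnectedComponent.sound
        (SimpleGraph.Adj.reachable ((SimpleGraph.fromEdgeSet_adj _).2 ⟨⟨j, j.2, hab⟩, hne⟩))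
    change ∑ i, H i j * y (G.connectedComponentMk i) = 0
    rw [← sum_subset (subset_univ {a, b}), sum_pair hne, (h1 a j).2 (by simp [hab]),
      (h1 b j).2 (by simp [hab]), hadj, CharTwo.add_self_eq_zero]
    intro i _ hi
    have : ¬ H i j = 1 := by
      rw [h1, hab, Sym2.mem_iff]
      simpa using hi
    rw [← ZMod.ne_zero_iff_eq_one, not_not] at this
    rw [this, zero_mul]
  have e4 := Submodule.finrank_mono e3
  rw [LinearMap.finrank_range_of_inj hΦ, Module.finrank_fintype_fun_eq_card] at e4
  rw [Nat.card_eq_fintype_card]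
  omega

end Ends

theorem IsTypeTwo.colRank_univ_lt (hH : IsTypeTwo m H) (hr : 0 < r) : H.colRank univ < r := by
  obtain ⟨ends, h1, h2⟩ := hH.exists_ends
  have h := colRank_add_card_connectedComponent_le h1 h2 univ
  have : Nonempty (Fin r) := ⟨⟨0, hr⟩⟩
  have := Nat.card_pos (α := (SimpleGraph.fromEdgeSet (ends '' (univ : Finset (Fin n)))).ConnectedComponent)
  omega

open Classical in
theorem IsTypeTwo.degree_eq (hH : IsTypeTwo m H) (hinj : Function.Injective fun j i => H i j)
    (i : Fin r) : (incidenceGraph H).degree i = m := by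
  obtain ⟨ends, h1, h2⟩ := hH.exists_ends
  rw [← hH.1 i, ← SimpleGraph.card_incidenceFinset_eq_degree, hammingNorm,
    ← card_image_of_injective _ (ends_injective h1 hinj)]
  congr 1
  ext e
  rw [SimpleGraph.mem_incidenceFinset, SimpleGraph.incidenceSet, incidenceGraph_edgeSet h1 h2]
  simp only [Set.mem_ofPred_eq, Set.mem_range, mem_image, mem_filter, mem_univ, true_and,
    ZMod.ne_zero_iff_eq_one, h1]
  constructor
  · rintro ⟨⟨j, rfl⟩, h⟩
    exact ⟨j, h, rfl⟩
  · rintro ⟨j, h, rfl⟩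
    exact ⟨⟨j, rfl⟩, h⟩

open Classical in
theorem incidenceGraph_edgeFinset {ends : Fin n → Sym2 (Fin r)}
    (h1 : ∀ i j, H i j = 1 ↔ i ∈ ends j) (h2 : ∀ j, ¬ (ends j).IsDiag)
    (hinj : Function.Injective fun j i => H i j) :
    (incidenceGraph H).edgeFinset = univ.map ⟨ends, ends_injective h1 hinj⟩ := by
  ext e
  rw [SimpleGraph.mem_edgeFinset, incidenceGraph_edgeSet h1 h2]
  simp

theorem IsTypeTwo.card_mul (hH : IsTypeTwo m H) (hinj : Function.Injective fun j i => H i j) :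
    r * m = 2 * n := by
  classical
  obtain ⟨ends, h1, h2⟩ := hH.exists_ends
  have h := (incidenceGraph H).sum_degrees_eq_twice_card_edges
  simpa [hH.degree_eq hinj, incidenceGraph_edgeFinset h1 h2 hinj] using h

/-- Upper bound for the expected rank of a random set of columns. -/
theorem IsTypeTwo.expectation_colRank_le (hH : IsTypeTwo m H)
    (hinj : Function.Injective fun j i => H i j) (hm : 2 ≤ m) {N : ℕ}
    (hN : (N : ℕ∞) < (incidenceGraph H).egirth) {p : ℝ} (h0 : 0 ≤ p) (h1 : p ≤ 1) :
    (expectation univ fun A => (H.colRank A : ℝ)).eval p ≤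
      r * (1 - ∑ k ∈ range N,
        ((rootedTrees m k).card : ℝ) / (k + 1) * (p ^ k * (1 - p) ^ (m + (m - 2) * k))) := by
  classical
  obtain ⟨ends, e1, e2⟩ := hH.exists_ends
  set φ : Fin n ↪ Sym2 (Fin r) := ⟨ends, ends_injective e1 hinj⟩
  have hpt : ∀ A ⊆ (univ : Finset (Fin n)), (H.colRank A : ℝ) ≤
      r - ∑ v, ((cluster (A.map φ) v).card : ℝ)⁻¹ := by
    intro A _
    rw [sum_inv_card_cluster, coe_map]
    have := colRank_add_card_connectedComponent_le e1 e2 A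
    have h : (H.colRank A : ℝ) +
      Nat.card (SimpleGraph.fromEdgeSet (ends '' A)).ConnectedComponent ≤ r := by exact_mod_cast this
    exact le_sub_iff_add_le.2 h
  refine (eval_expectation_mono h0 h1 hpt).trans ?_
  rw [expectation_sub, expectation_const, expectation_sum, Polynomial.eval_sub, Polynomial.eval_C,
    Polynomial.eval_finsetSum, mul_sub, mul_one]
  refine sub_le_sub_left ?_ _
  conv_lhs => rw [← Fintype.card_fin r, ← nsmul_eq_mul, Fintype.card_fin, ← Fintype.card_fin r, ← card_univ]
  refine card_nsmul_le_sum _ _ _ fun v _ => ?_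
  have := sum_rootedTrees_le_expectation_inv_card_cluster (hH.degree_eq hinj) hm hN v h0 h1
  rw [incidenceGraph_edgeFinset e1 e2 hinj, expectation_map] at this
  exact this

end TypeTwo

theorem incidenceGirth_eq {m r n : ℕ} (hm : 3 ≤ m) {H : Matrix (Fin r) (Fin n) (ZMod 2)}
    (h : incidenceGirth H = m) :
    (Function.Injective fun j i => H i j) ∧ (incidenceGraph H).egirth = m := by
  unfold incidenceGirth at h
  split_ifs at h with h1
  · exact ⟨h1, h⟩
  · have : (2 : ℕ) = m := by exact_mod_cast h
    omega

/-! ### The rate bound for proper codes -/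

namespace CSSCode

open Finset Percolation RegularTree

variable {C : CSSCode} {m : ℕ}

theorem restrictedRank_le_univ (C : CSSCode) (A : Finset (Fin C.n)) :
    C.restrictedRank A ≤ C.restrictedRank univ := by
  simp only [restrictedRank, Matrix.colRank_eq_finrank_colSpan]
  exact add_le_add (Submodule.finrank_mono (Matrix.colSpan_mono _ (subset_univ _)))
    (Submodule.finrank_mono (Matrix.colSpan_mono _ (subset_univ _)))

/-- Adding the rank inequalities for A and Aᶜ would give n ≤ ρ(univ), so one of the two is
uncorrectable. At p = 1/2 both have the same law, and the probability increases with p. -/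
theorem half_le_uncorrectableProb (C : CSSCode) (h : C.restrictedRank univ < C.n) {p : ℝ}
    (hp : 1 / 2 ≤ p) (hp1 : p ≤ 1) : 1 / 2 ≤ C.uncorrectableProb p := by
  classical
  set g : Finset (Fin C.n) → ℝ := fun A => if C.Uncorrectable A then 1 else 0 with hg
  have hpt : ∀ A ⊆ (univ : Finset (Fin C.n)), 1 ≤ g A + g Aᶜ := by
    intro A _
    by_cases h1 : C.Uncorrectable A
    · simp only [hg, if_pos h1]
      split_ifs <;> norm_num
    · by_cases h2 : C.Uncorrectable Aᶜ
      · simp only [hg, if_neg h1, if_pos h2]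
        norm_num
      · exfalso
        have e1 := mt C.uncorrectable_of_restrictedRank h1
        have e2 := mt C.uncorrectable_of_restrictedRank h2
        rw [compl_compl, card_compl, Fintype.card_fin] at e2
        have := card_le_univ A
        rw [Fintype.card_fin] at this
        omega
  have hE := eval_expectation_mono (p := 1 / 2) (by norm_num) (by norm_num) hpt
  rw [expectation_const, Polynomial.eval_C, expectation_add, Polynomial.eval_add,
    eval_expectation_compl, show (1 : ℝ) - 1 / 2 = 1 / 2 by norm_num] at hE
  have hmono := expectation_monotoneOn univ g (fun A B hAB _ => by
    simp only [hg]
    split_ifs with h1 h2 h2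
    · exact le_rfl
    · exact absurd (h1.mono hAB) h2
    · exact zero_le_one
    · exact le_rfl) (a := 1 / 2) ⟨by norm_num, by norm_num⟩ (b := p) ⟨by linarith, hp1⟩ hp
  have : C.uncorrectableProb p = (expectation univ g).eval p := by
    unfold uncorrectableProb
    congr!
  rw [this]
  simp only at hmono
  linarith

/-- Upper bound on the dimension of a code by the expected ranks of its submatrices. -/
theorem sub_restrictedRank_le (C : CSSCode) {p : ℝ} (h0 : 0 < p) (h1 : p < 1 / 2) :
    (C.n : ℝ) - C.restrictedRank univ ≤
      (1 - 2 * p) * ((expectation univ fun A => (C.restrictedRank A : ℝ)).eval p / p - C.n) +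
        2 * C.n * C.uncorrectableProb p * ((1 - p) / p) := by
  classical
  set g : Finset (Fin C.n) → ℝ := fun A => if C.Uncorrectable A then 1 else 0 with hg
  set ρ : Finset (Fin C.n) → ℝ := fun A => (C.restrictedRank A : ℝ) with hρ
  set ψ : ℝ → ℝ := fun q => (expectation univ ρ).eval q with hψ
  have hpt : ∀ A ⊆ (univ : Finset (Fin C.n)),
      2 * (A.card : ℝ) + ρ Aᶜ ≤ 2 * C.n * g A + (ρ univ + ρ A) := by
    intro A _
    by_cases hA : C.Uncorrectable A
    · simp only [hg, if_pos hA, hρ]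
      have e1 := card_le_univ A
      rw [Fintype.card_fin] at e1
      have e2 := C.restrictedRank_le_univ Aᶜ
      have : 2 * A.card + C.restrictedRank Aᶜ ≤
        2 * C.n * 1 + (C.restrictedRank univ + C.restrictedRank A) := by omega
      exact_mod_cast this
    · simp only [hg, if_neg hA, hρ, mul_zero, zero_add]
      have := mt C.uncorrectable_of_restrictedRank hA
      exact_mod_cast not_lt.1 this
  have hE := eval_expectation_mono (p := p) h0.le (by linarith) hpt
  rw [expectation_add, expectation_const_mul, expectation_add, expectation_const_mul,
    expectation_add, expectation_const] at hE
  simp only [Polynomial.eval_add, Polynomial.eval_mul, Polynomial.eval_C, eval_expectation_compl,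
    eval_expectation_card, card_univ, Fintype.card_fin] at hE
  have hP : C.uncorrectableProb p = (expectation univ g).eval p := by
    unfold uncorrectableProb
    congr!
  have hconc : ConcaveOn ℝ (Set.Icc 0 1) ψ :=
    expectation_concaveOn univ ρ fun A B i hAB _ _ => by
      have e1 := C.HX.colRank_submodular hAB i
      have e2 := C.HZ.colRank_submodular hAB i
      simp only [hρ, restrictedRank]
      push_cast
      linarith
  -- The slope comparison reads (1 - p)ψ(1 - p) ≥ (1 - 2p)ρ(univ) + pψ(p); inserted in 1 - p times
  -- `hE`, it removes ψ(1 - p).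
  have hs := hconc.slope_anti_adjacent (x := p) (y := 1 - p) (z := 1) ⟨h0.le, by linarith⟩
    ⟨by norm_num, le_rfl⟩ (by linarith) (by linarith)
  have hψ1 : ψ 1 = ρ univ := eval_one_expectation _ _
  rw [hψ1, sub_sub_cancel, div_le_div_iff₀ h0 (by linarith)] at hs
  rw [← hP] at hE
  change 2 * (p * C.n) + ψ (1 - p) ≤ 2 * C.n * C.uncorrectableProb p + (ρ univ + ψ p) at hE
  change C.n - ρ univ ≤ (1 - 2 * p) * (ψ p / p - C.n) +
    2 * C.n * C.uncorrectableProb p * ((1 - p) / p)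
  set P := C.uncorrectableProb p
  have e : (1 - 2 * p) * (ψ p / p - C.n) + 2 * C.n * P * ((1 - p) / p) =
    ((1 - 2 * p) * (ψ p - p * C.n) + 2 * C.n * P * (1 - p)) / p := by
    field_simp
  rw [e, le_div_iff₀ h0]
  nlinarith [mul_le_mul_of_nonneg_left hE (show 0 ≤ 1 - p by linarith)]

/-- For m = 4 there are exactly n rows; strictness then comes from the dependency among the rows of
each matrix. -/
theorem IsProper.restrictedRank_lt (hC : C.IsProper m) (hm : 4 ≤ m) :
    C.restrictedRank univ < C.n := by
  have eX := hC.isTwoM.1.card_mul (incidenceGirth_eq (by omega) hC.girthX).1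
  have eZ := hC.isTwoM.2.card_mul (incidenceGirth_eq (by omega) hC.girthZ).1
  have pX : 0 < C.rX := Fin.pos_iff_nonempty.2 hC.connectedX.nonempty
  have pZ : 0 < C.rZ := Fin.pos_iff_nonempty.2 hC.connectedZ.nonempty
  have lX := hC.isTwoM.1.colRank_univ_lt pX
  have lZ := hC.isTwoM.2.colRank_univ_lt pZ
  have := Nat.mul_le_mul_left C.rX hm
  have := Nat.mul_le_mul_left C.rZ hm
  unfold restrictedRank
  omega

/-- The rate bound, with an error term that depends on the probability of an uncorrectable
erasure. -/
theorem IsProper.le_rateBound_add (hC : C.IsProper m) (hm : 4 ≤ m) {p : ℝ} (h0 : 0 < p)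
    (h1 : p < 1 / 2) :
    1 - 4 / (m : ℝ) ≤ rateBound m p + 2 * C.uncorrectableProb p * ((1 - p) / p) := by
  obtain ⟨iX, gX⟩ := incidenceGirth_eq (by omega) hC.girthX
  obtain ⟨iZ, gZ⟩ := incidenceGirth_eq (by omega) hC.girthZ
  have eX := hC.isTwoM.1.card_mul iX
  have eZ := hC.isTwoM.2.card_mul iZ
  have hlt := hC.restrictedRank_lt hm
  have hn : (0 : ℝ) < C.n := by exact_mod_cast (Nat.zero_le _).trans_lt hlt
  have hm0 : (0 : ℝ) < m := by exact_mod_cast (show 0 < m by omega)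
  have hr : C.restrictedRank univ ≤ C.rX + C.rZ := by
    have a := C.HX.colRank_le_card univ
    have b := C.HZ.colRank_le_card univ
    simp only [Fintype.card_fin] at a b
    exact add_le_add a b
  -- Trees with at most m - 2 edges have at most m - 1 vertices, below the girth; this is where the
  -- sum is truncated.
  have hN : ((m - 1 : ℕ) : ℕ∞) < m := by exact_mod_cast (show m - 1 < m by omega)
  have bX := hC.isTwoM.1.expectation_colRank_le iX (by omega) (gX ▸ hN) h0.le (by linarith)
  have bZ := hC.isTwoM.2.expectation_colRank_le iZ (by omega) (gZ ▸ hN) h0.le (by linarith)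
  have key := C.sub_restrictedRank_le h0 h1
  set s := ∑ k ∈ range (m - 1),
        ((rootedTrees m k).card : ℝ) / (k + 1) * (p ^ k * (1 - p) ^ (m + (m - 2) * k)) with hs
  have hf : (1 - p) ^ m * subtreeSum m (m - 2) (p * (1 - p) ^ (m - 2)) ≤ s := by
    rw [subtreeSum, show m - 2 + 1 = m - 1 by omega, mul_sum, hs]
    refine sum_le_sum fun k _ => ?_
    have : ((numSubtrees m k : ℕ) : ℝ) ≤ (rootedTrees m k).card := by
      exact_mod_cast numSubtrees_le m k
    have e : (1 - p) ^ m * ((numSubtrees m k : ℝ) / (k + 1) * (p * (1 - p) ^ (m - 2)) ^ k) =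
      (numSubtrees m k : ℝ) / (k + 1) * (p ^ k * (1 - p) ^ (m + (m - 2) * k)) := by
      rw [mul_pow, ← pow_mul, pow_add]
      ring
    rw [e]
    have := weight_nonneg h0.le (show p ≤ 1 by linarith) k (m + (m - 2) * k)
    gcongr
  have hψ : (expectation univ fun A => (C.restrictedRank A : ℝ)).eval p ≤
      (C.rX + C.rZ) * (1 - s) := by
    have : (expectation univ fun A => (C.restrictedRank A : ℝ)) =
        (expectation univ fun A => (C.HX.colRank A : ℝ)) +
          expectation univ fun A => (C.HZ.colRank A : ℝ) := by
      rw [← expectation_add]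
      simp only [restrictedRank, Nat.cast_add]
    rw [this, Polynomial.eval_add]
    linarith
  have hrows : (C.rX + C.rZ : ℝ) = 4 / m * C.n := by
    have a : (C.rX * m : ℝ) = 2 * C.n := by exact_mod_cast eX
    have b : (C.rZ * m : ℝ) = 2 * C.n := by exact_mod_cast eZ
    field_simp
    linarith
  have hr' : (C.restrictedRank univ : ℝ) ≤ 4 / m * C.n := by
    rw [← hrows]
    exact_mod_cast hr
  rw [hrows] at hψ
  set f := (1 - p) ^ m * subtreeSum m (m - 2) (p * (1 - p) ^ (m - 2)) with hfdef
  have hψ2 : (expectation univ fun A => (C.restrictedRank A : ℝ)).eval p / p ≤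
      C.n * (4 / (m * p) * (1 - f)) := by
    rw [div_le_iff₀ h0]
    have e : C.n * (4 / (m * p) * (1 - f)) * p = 4 / m * C.n * (1 - f) := by field_simp
    rw [e]
    refine hψ.trans (mul_le_mul_of_nonneg_left (by linarith) (by positivity))
  have h2 : C.n * (1 - 4 / (m : ℝ)) ≤
      C.n * (rateBound m p + 2 * C.uncorrectableProb p * ((1 - p) / p)) := by
    have h3 := mul_le_mul_of_nonneg_left (sub_le_sub_right hψ2 (C.n : ℝ))
      (show 0 ≤ 1 - 2 * p by linarith)
    have e : rateBound m p = (1 - 2 * p) * (4 / (m * p) * (1 - f) - 1) := rfl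
    rw [e]
    linarith
  exact le_of_mul_le_mul_left h2 hn

end CSSCode

/-! ### Analysis of the truncated cluster series -/

namespace ClusterSeries

open Finset

/-- The truncated series `∑ a_k z ^ k`. -/
def series (a : ℕ → ℝ) (N : ℕ) (z : ℝ) : ℝ := ∑ k ∈ range N, a k * z ^ k

/-- The truncated series `∑ a_k z ^ k / (k + 1)`. -/
noncomputable def avgSeries (a : ℕ → ℝ) (N : ℕ) (z : ℝ) : ℝ :=
  ∑ k ∈ range N, a k / ((k : ℝ) + 1) * z ^ k

theorem hasDerivAt_mul_avgSeries (a : ℕ → ℝ) (N : ℕ) (z : ℝ) :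
    HasDerivAt (fun z => z * avgSeries a N z) (series a N z) z := by
  have h : ∀ k ∈ range N, HasDerivAt (fun z : ℝ => a k / ((k : ℝ) + 1) * z ^ (k + 1))
      (a k * z ^ k) z := by
    intro k _
    refine ((hasDerivAt_pow (k + 1) z).const_mul _).congr_deriv ?_
    have : (k : ℝ) + 1 ≠ 0 := by positivity
    push_cast
    field_simp
  refine (HasDerivAt.fun_sum h).congr_of_eventuallyEq (Filter.Eventually.of_forall fun z => ?_)
  simp only [avgSeries, mul_sum]
  exact sum_congr rfl fun k _ => by ring

/-- The argument of the series at the probability `x`, for the `(d + 4)`-regular tree. -/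
def arg (d : ℕ) (x : ℝ) : ℝ := x * (1 - x) ^ (d + 2)

theorem hasDerivAt_arg (d : ℕ) (x : ℝ) :
    HasDerivAt (arg d) ((1 - x) ^ (d + 1) * (1 - (d + 3) * x)) x := by
  refine ((hasDerivAt_id x).mul (((hasDerivAt_id x).const_sub 1).pow (d + 2))).congr_deriv ?_
  simp only [id, Pi.pow_apply, show d + 2 - 1 = d + 1 from rfl]
  push_cast
  ring

theorem continuous_arg (d : ℕ) : Continuous (arg d) := by
  unfold arg; fun_prop

/-- A probability in the subcritical interval has the same argument. -/
theorem exists_dual {d : ℕ} {y : ℝ} (h0 : 1 / ((d : ℝ) + 3) ≤ y) (h1 : y < 1) :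
    ∃ x, 0 < x ∧ x ≤ 1 / ((d : ℝ) + 3) ∧ arg d x = arg d y := by
  have hd : (0 : ℝ) < (d : ℝ) + 3 := by positivity
  have hc : 0 < 1 / ((d : ℝ) + 3) := by positivity
  have hanti : AntitoneOn (arg d) (Set.Icc (1 / ((d : ℝ) + 3)) 1) := by
    refine antitoneOn_of_deriv_nonpos (convex_Icc _ _) (continuous_arg d).continuousOn
      (fun x _ => (hasDerivAt_arg d x).differentiableAt.differentiableWithinAt) fun x hx => ?_
    rw [interior_Icc] at hx
    rw [(hasDerivAt_arg d x).deriv]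
    refine mul_nonpos_of_nonneg_of_nonpos (pow_nonneg (by linarith [hx.2]) _) ?_
    have := (div_lt_iff₀' hd).1 hx.1
    linarith
  have hy : 0 < arg d y := mul_pos (hc.trans_le h0) (pow_pos (by linarith) _)
  have h2 : arg d y ∈ Set.Icc (arg d 0) (arg d (1 / ((d : ℝ) + 3))) :=
    ⟨by simpa [arg] using hy.le, hanti ⟨le_rfl, h0.trans h1.le⟩ ⟨h0, h1.le⟩ h0⟩
  obtain ⟨x, hx, e⟩ := intermediate_value_Icc hc.le (continuous_arg d).continuousOn h2
  refine ⟨x, lt_of_le_of_ne hx.1 fun h => ?_, hx.2, e⟩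
  rw [← h, arg, zero_mul] at e
  exact hy.ne e

variable {a : ℕ → ℝ} {N d : ℕ}

/-- The expected inverse cluster size. -/
noncomputable def invClusterSize (a : ℕ → ℝ) (N d : ℕ) (x : ℝ) : ℝ :=
  (1 - x) ^ (d + 4) * avgSeries a N (arg d x)

theorem invClusterSize_le
    (hA : ∀ x, 0 ≤ x → x ≤ 1 → series a N (arg d x) * (1 - x) ^ (d + 4) ≤ 1)
    {x : ℝ} (h0 : 0 < x) (h1 : x ≤ 1 / ((d : ℝ) + 3)) :
    invClusterSize a N d x ≤ 1 - (d + 4) * x / 2 := by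
  have hd : (0 : ℝ) < (d : ℝ) + 3 := by positivity
  have hc : 1 / ((d : ℝ) + 3) < 1 := by
    rw [div_lt_one hd]; linarith [(Nat.cast_nonneg d : (0 : ℝ) ≤ d)]
  -- The subtracted function is what the first term would be if `hA` were an equality: the integral
  -- from 0 of (1 - x)^(-(d+4)) times the derivative of `arg d`.
  set U : ℝ → ℝ := fun x => arg d x * avgSeries a N (arg d x) -
    (x - (d + 4) * x ^ 2 / 2) / (1 - x) ^ 2 with hU
  have hder : ∀ x : ℝ, x < 1 → HasDerivAt U
      (series a N (arg d x) * ((1 - x) ^ (d + 1) * (1 - (d + 3) * x)) -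
        (1 - (d + 3) * x) / (1 - x) ^ 3) x := by
    intro x hx
    have hx' : 1 - x ≠ 0 := by linarith
    have e1 := (hasDerivAt_mul_avgSeries a N (arg d x)).comp x (hasDerivAt_arg d x)
    have e2 : HasDerivAt (fun x : ℝ => (x - (d + 4) * x ^ 2 / 2) / (1 - x) ^ 2)
        ((1 - (d + 3) * x) / (1 - x) ^ 3) x := by
      have n := (hasDerivAt_id x).sub ((((hasDerivAt_pow 2 x).const_mul ((d : ℝ) + 4))).div_const 2)
      have q := ((hasDerivAt_id x).const_sub 1).pow 2
      refine (n.div q (pow_ne_zero _ hx')).congr_deriv ?_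
      simp
      field_simp
      ring
    exact e1.sub e2
  have hanti : AntitoneOn U (Set.Icc 0 (1 / ((d : ℝ) + 3))) := by
    refine antitoneOn_of_deriv_nonpos (convex_Icc _ _)
      (fun x hx => (hder x (hx.2.trans_lt hc)).continuousAt.continuousWithinAt)
      (fun x hx => ?_) fun x hx => ?_
    · rw [interior_Icc] at hx
      exact (hder x (hx.2.trans hc)).differentiableAt.differentiableWithinAt
    · rw [interior_Icc] at hx
      have hx1 : 0 < 1 - x := by linarith [hx.2.trans hc]
      rw [(hder x (hx.2.trans hc)).deriv, sub_nonpos, le_div_iff₀ (by positivity)]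
      have h2 := (lt_div_iff₀' hd).1 hx.2
      have h3 := mul_le_mul_of_nonneg_right (hA x hx.1.le (by linarith))
        (show 0 ≤ 1 - (d + 3) * x by linarith)
      calc _ = series a N (arg d x) * (1 - x) ^ (d + 4) * (1 - (d + 3) * x) := by ring
        _ ≤ _ := by linarith
  have hx1 : 0 < 1 - x := by linarith
  have h := hanti (a := 0) ⟨le_rfl, h0.le.trans h1⟩ ⟨h0.le, h1⟩ h0.le
  have hU0 : U 0 = 0 := by simp [hU, arg]
  rw [hU0] at h
  have h2 : arg d x * avgSeries a N (arg d x) ≤ (x - (d + 4) * x ^ 2 / 2) / (1 - x) ^ 2 := by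
    simpa [hU] using h
  rw [le_div_iff₀ (by positivity)] at h2
  refine le_of_mul_le_mul_left ?_ h0
  calc x * invClusterSize a N d x
      = arg d x * avgSeries a N (arg d x) * (1 - x) ^ 2 := by rw [invClusterSize, arg]; ring
    _ ≤ _ := h2
    _ = _ := by ring

theorem hasDerivAt_one_sub_invClusterSize_div (a : ℕ → ℝ) (N d : ℕ) {x : ℝ} (hx : x ≠ 0) :
    HasDerivAt (fun x => (1 - invClusterSize a N d x) / x)
      (((1 - x) ^ (d + 3) * (2 * avgSeries a N (arg d x) + ((d + 3) * x - 1) *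
        series a N (arg d x)) - 1) / x ^ 2) x := by
  have e1 := (hasDerivAt_mul_avgSeries a N (arg d x)).comp x (hasDerivAt_arg d x)
  have e2 := ((hasDerivAt_id x).const_sub 1).pow 2
  have e3 := ((hasDerivAt_id x).sub (e2.mul e1)).div (hasDerivAt_pow 2 x) (pow_ne_zero 2 hx)
  have heq : (fun x => (1 - invClusterSize a N d x) / x) =ᶠ[nhds x]
      fun x => (x - (1 - x) ^ 2 * (arg d x * avgSeries a N (arg d x))) / x ^ 2 := by
    filter_upwards [isOpen_ne.mem_nhds hx] with y (hy : y ≠ 0)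
    rw [invClusterSize]
    generalize avgSeries a N (arg d y) = S
    rw [arg]
    field_simp
    ring
  refine (HasDerivAt.congr_of_eventuallyEq e3 heq).congr_deriv ?_
  simp only [id, Function.comp_apply, Pi.pow_apply, Pi.sub_apply, Pi.mul_apply]
  generalize series a N (arg d x) = A
  generalize avgSeries a N (arg d x) = S
  rw [arg]
  field_simp
  push_cast
  ring

theorem antitoneOn_one_sub_invClusterSize_div
    (hA : ∀ x, 0 ≤ x → x ≤ 1 → series a N (arg d x) * (1 - x) ^ (d + 4) ≤ 1) :
    AntitoneOn (fun x => (1 - invClusterSize a N d x) / x)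
      (Set.Icc (1 / ((d : ℝ) + 3)) (1 / 2)) := by
  have hd : (0 : ℝ) < (d : ℝ) + 3 := by positivity
  have hc : 0 < 1 / ((d : ℝ) + 3) := by positivity
  have hder := fun (x : ℝ) (hx : 1 / ((d : ℝ) + 3) ≤ x) =>
    hasDerivAt_one_sub_invClusterSize_div a N d (hc.trans_le hx).ne'
  refine antitoneOn_of_deriv_nonpos (convex_Icc _ _)
    (fun x hx => (hder x hx.1).continuousAt.continuousWithinAt)
    (fun x hx => (hder x (interior_subset hx).1).differentiableAt.differentiableWithinAt)
    fun y hy => ?_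
  rw [interior_Icc] at hy
  rw [(hder y hy.1.le).deriv]
  refine div_nonpos_of_nonpos_of_nonneg ?_ (sq_nonneg _)
  obtain ⟨x, hx0, hx1, hxy⟩ := exists_dual hy.1.le (by linarith [hy.2])
  have hy0 : 0 < y := hc.trans hy.1
  have hy1 : 0 < 1 - y := by linarith [hy.2]
  have hx2 : 0 < 1 - x := by linarith [hy.1, hy.2]
  have hdy := (div_lt_iff₀' hd).1 hy.1
  have hdx := (le_div_iff₀' hd).1 hx1
  have b1 := hA x hx0.le (by linarith)
  have b2 := invClusterSize_le hA hx0 hx1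
  rw [invClusterSize] at b2
  rw [hxy] at b1 b2
  set A := series a N (arg d y)
  set S := avgSeries a N (arg d y)
  -- A and S depend on y only through `arg d y`, so they can be bounded at the subcritical x, where
  -- the estimates are sharper.
  have b3 : (2 * S + ((d + 3) * y - 1) * A) * (1 - x) ^ (d + 4) ≤ 1 - (d + 4) * x + (d + 3) * y := by
    have := mul_le_mul_of_nonneg_left b1 (show 0 ≤ (d + 3) * y - 1 by linarith)
    linarith
  have b4 : y * (1 - y) ^ (d + 3) = x * (1 - x) ^ (d + 2) * (1 - y) := by
    have : x * (1 - x) ^ (d + 2) = y * (1 - y) ^ (d + 2) := hxy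
    rw [this]
    ring
  -- The difference of the two sides factors as (y - x)(1 - xy - (d+4)x(1 - y)), and (d+3)x ≤ 1
  -- makes the second factor at least y - x.
  have b5 : x * (1 - y) * (1 - (d + 4) * x + (d + 3) * y) ≤ y * (1 - x) ^ 2 := by
    have hle : x ≤ y := hx1.trans hy.1.le
    have : 0 ≤ 1 - x * y - (d + 4) * x * (1 - y) := by nlinarith
    nlinarith [mul_nonneg (sub_nonneg.2 hle) this]
  rw [sub_nonpos]
  have hpos : 0 < y * (1 - x) ^ (d + 4) := by positivity
  refine le_of_mul_le_mul_left ?_ hpos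
  calc y * (1 - x) ^ (d + 4) * ((1 - y) ^ (d + 3) * (2 * S + ((d + 3) * y - 1) * A))
      = y * (1 - y) ^ (d + 3) * ((2 * S + ((d + 3) * y - 1) * A) * (1 - x) ^ (d + 4)) := by ring
    _ ≤ y * (1 - y) ^ (d + 3) * (1 - (d + 4) * x + (d + 3) * y) :=
        mul_le_mul_of_nonneg_left b3 (by positivity)
    _ = (1 - x) ^ (d + 2) * (x * (1 - y) * (1 - (d + 4) * x + (d + 3) * y)) := by rw [b4]; ring
    _ ≤ (1 - x) ^ (d + 2) * (y * (1 - x) ^ 2) := mul_le_mul_of_nonneg_left b5 (by positivity)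
    _ = y * (1 - x) ^ (d + 4) * 1 := by ring

theorem invClusterSize_half_lt
    (hA : ∀ x, 0 ≤ x → x ≤ 1 → series a N (arg 0 x) * (1 - x) ^ (0 + 4) ≤ 1) :
    invClusterSize a N 0 (1 / 2) < 1 / 2 := by
  obtain ⟨x, hx0, hx1, hxy⟩ := exists_dual (d := 0) (y := 1 / 2) (by norm_num) (by norm_num)
  have b := invClusterSize_le hA hx0 hx1
  rw [invClusterSize] at b ⊢
  rw [hxy] at b
  norm_num at b hx1 ⊢
  have h1 : (2 / 3 : ℝ) ≤ 1 - x := by linarith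
  have h2 : (2 / 3 : ℝ) ^ 4 ≤ (1 - x) ^ 4 := pow_le_pow_left₀ (by norm_num) h1 4
  by_contra! h
  have h3 : (8 : ℝ) ≤ avgSeries a N (arg 0 (1 / 2)) := by linarith
  have h4 := mul_le_mul h2 h3 (by norm_num) (by positivity)
  linarith

end ClusterSeries

/-! ### Unique crossing and the threshold -/

section Threshold

open Finset ClusterSeries RegularTree

theorem series_numSubtrees_le (d N : ℕ) (x : ℝ) (h0 : 0 ≤ x) (h1 : x ≤ 1) :
    series (fun k => (numSubtrees (d + 4) k : ℝ)) N (arg d x) * (1 - x) ^ (d + 4) ≤ 1 := by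
  refine le_trans ?_ (sum_card_rootedTrees_le (m := d + 4) (by omega) N h0 h1)
  rw [series, sum_mul]
  refine sum_le_sum fun k _ => ?_
  have h : ((numSubtrees (d + 4) k : ℕ) : ℝ) ≤ (rootedTrees (d + 4) k).card := by
    exact_mod_cast numSubtrees_le _ k
  have e : (numSubtrees (d + 4) k : ℝ) * arg d x ^ k * (1 - x) ^ (d + 4) =
      numSubtrees (d + 4) k * (x ^ k * (1 - x) ^ (d + 4 + (d + 4 - 2) * k)) := by
    rw [arg, mul_pow, ← pow_mul, pow_add, show d + 4 - 2 = d + 2 by omega]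
    ring
  rw [e]
  exact mul_le_mul_of_nonneg_right h (Percolation.weight_nonneg h0 h1 _ _)

/-- The expected inverse size of the cluster of the root, restricted to small clusters. -/
noncomputable def smallClusterMean (d : ℕ) (p : ℝ) : ℝ :=
  invClusterSize (fun k => (numSubtrees (d + 4) k : ℝ)) (d + 3) d p

theorem rateBound_eq (d : ℕ) (p : ℝ) :
    rateBound (d + 4) p =
      (1 - 2 * p) * (4 / ((d : ℝ) + 4) * ((1 - smallClusterMean d p) / p) - 1) := by
  rw [rateBound, smallClusterMean, invClusterSize]
  push_cast
  rw [mul_div_assoc', ← div_mul_eq_mul_div, div_div]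
  rfl

theorem lt_rateBound {d : ℕ} {p : ℝ} (h0 : 0 < p) (h1 : p ≤ 1 / ((d : ℝ) + 3)) :
    1 - 4 / ((d : ℝ) + 4) < rateBound (d + 4) p := by
  have hd : (0 : ℝ) ≤ d := Nat.cast_nonneg d
  have hf := invClusterSize_le (series_numSubtrees_le d (d + 3)) h0 h1
  have hg : 1 ≤ 4 / ((d : ℝ) + 4) * ((1 - smallClusterMean d p) / p) - 1 := by
    have : ((d : ℝ) + 4) / 2 ≤ (1 - smallClusterMean d p) / p := by
      rw [le_div_iff₀ h0, smallClusterMean]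
      linarith
    have h2 := mul_le_mul_of_nonneg_left this (show 0 ≤ 4 / ((d : ℝ) + 4) by positivity)
    have h3 : 4 / ((d : ℝ) + 4) * (((d : ℝ) + 4) / 2) = 2 := by field_simp; norm_num
    linarith
  have h4 : 2 / ((d : ℝ) + 3) < 4 / ((d : ℝ) + 4) := by
    rw [div_lt_div_iff₀ (by positivity) (by positivity)]
    linarith
  have h5 : 2 / ((d : ℝ) + 3) = 2 * (1 / ((d : ℝ) + 3)) := by ring
  have h6 : 4 / ((d : ℝ) + 4) ≤ 1 := by
    rw [div_le_one (by positivity)]; linarith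
  rw [rateBound_eq]
  have h7 := mul_le_mul_of_nonneg_left hg (show 0 ≤ 1 - 2 * p by linarith)
  linarith

/-- The bound is 1 - 2p, strictly decreasing, times a nonincreasing g, so it suffices that g(u) > 0.
For m > 4 this follows from the equation at u; for m = 4 the level is 0, and
`invClusterSize_half_lt` gives g(1/2) > 0 instead. -/
theorem rateBound_lt_of_eq {d : ℕ} {u v : ℝ} (hu : 1 / ((d : ℝ) + 3) ≤ u) (huv : u < v)
    (hv : v ≤ 1 / 2) (h : 1 - 4 / ((d : ℝ) + 4) = rateBound (d + 4) u) :
    rateBound (d + 4) v < 1 - 4 / ((d : ℝ) + 4) := by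
  have hanti := antitoneOn_one_sub_invClusterSize_div (series_numSubtrees_le d (d + 3))
  set g : ℝ → ℝ := fun p => 4 / ((d : ℝ) + 4) * ((1 - smallClusterMean d p) / p) - 1 with hg
  have hgle : ∀ {s t : ℝ}, 1 / ((d : ℝ) + 3) ≤ s → s ≤ t → t ≤ 1 / 2 → g t ≤ g s := by
    intro s t hs hst ht
    have := hanti ⟨hs, hst.trans ht⟩ ⟨hs.trans hst, ht⟩ hst
    exact sub_le_sub_right (mul_le_mul_of_nonneg_left this (by positivity)) _
  have hr : ∀ p, rateBound (d + 4) p = (1 - 2 * p) * g p := rateBound_eq d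
  have hgu : 0 < g u := by
    rcases Nat.eq_zero_or_pos d with rfl | hd
    · refine lt_of_lt_of_le ?_ (hgle hu (huv.le.trans hv) le_rfl)
      have := invClusterSize_half_lt (series_numSubtrees_le 0 (0 + 3))
      simp only [hg, smallClusterMean]
      norm_num at this ⊢
      linarith
    · have hpos : 0 < 1 - 4 / ((d : ℝ) + 4) := by
        rw [sub_pos, div_lt_one (by positivity)]
        have : (0 : ℝ) < d := by exact_mod_cast hd
        linarith
      rw [h, hr] at hpos
      exact pos_of_mul_pos_right hpos (by linarith)
  rw [h, hr, hr]
  calc (1 - 2 * v) * g v ≤ (1 - 2 * v) * g u :=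
        mul_le_mul_of_nonneg_left (hgle hu huv.le hv) (by linarith)
    _ < (1 - 2 * u) * g u := mul_lt_mul_of_pos_right (by linarith) hgu

theorem exists_eq_rateBound (d : ℕ) :
    ∃ p, 1 / ((d : ℝ) + 3) ≤ p ∧ p ≤ 1 / 2 ∧ 1 - 4 / ((d : ℝ) + 4) = rateBound (d + 4) p := by
  have hd : (0 : ℝ) ≤ d := Nat.cast_nonneg d
  have hc : 0 < 1 / ((d : ℝ) + 3) := by positivity
  have hc2 : 1 / ((d : ℝ) + 3) ≤ 1 / 2 := one_div_le_one_div_of_le (by norm_num) (by linarith)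
  have hcont : ContinuousOn (rateBound (d + 4)) (Set.Icc (1 / ((d : ℝ) + 3)) (1 / 2)) := by
    intro p hp
    have hp0 := (hc.trans_le hp.1).ne'
    have h := (hasDerivAt_one_sub_invClusterSize_div
      (fun k => (numSubtrees (d + 4) k : ℝ)) (d + 3) d hp0).continuousAt
    rw [show rateBound (d + 4) = _ from funext (rateBound_eq d)]
    refine ContinuousAt.continuousWithinAt ?_
    exact (by fun_prop : ContinuousAt (fun p : ℝ => 1 - 2 * p) p).mul
      ((continuousAt_const.mul h).sub continuousAt_const)
  have h4 : 4 / ((d : ℝ) + 4) ≤ 1 := by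
    rw [div_le_one (by positivity)]; linarith
  have h := intermediate_value_Icc' hc2 hcont (show 1 - 4 / ((d : ℝ) + 4) ∈ _ from
    ⟨by rw [rateBound_eq]; norm_num; exact h4, (lt_rateBound hc le_rfl).le⟩)
  obtain ⟨p, hp, e⟩ := h
  exact ⟨p, hp.1, hp.2, e.symm⟩

open CSSCode Filter in
theorem le_rateBound_of_tendsto {m : ℕ} (hm : 4 ≤ m) {C : ℕ → CSSCode}
    (hC : ∀ t, (C t).IsProper m) {p : ℝ} (h0 : 0 < p) (h1 : p ≤ 1)
    (h : Tendsto (fun t => (C t).decodingErrorProb p) atTop (nhds 0)) :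
    p < 1 / 2 ∧ 1 - 4 / (m : ℝ) ≤ rateBound m p := by
  have hlt : p < 1 / 2 := by
    by_contra! hp
    have h2 : ∀ t, (1 / 4 : ℝ) ≤ (C t).decodingErrorProb p := by
      intro t
      have e1 := (C t).half_le_uncorrectableProb ((hC t).restrictedRank_lt hm) hp h1
      have e2 := (C t).uncorrectableProb_le_decodingErrorProb h0.le h1
      linarith
    have := ge_of_tendsto' h h2
    norm_num at this
  refine ⟨hlt, ?_⟩
  have h2 : Tendsto (fun t => rateBound m p + 2 * (2 * (C t).decodingErrorProb p) * ((1 - p) / p))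
      atTop (nhds (rateBound m p + 2 * (2 * 0) * ((1 - p) / p))) :=
    (((h.const_mul 2).const_mul 2).mul_const _).const_add _
  have h3 := ge_of_tendsto' h2 (b := 1 - 4 / (m : ℝ)) fun t => by
    have e1 := (hC t).le_rateBound_add hm h0 hlt
    have e2 := (C t).uncorrectableProb_le_decodingErrorProb h0.le h1
    have e3 : 0 ≤ (1 - p) / p := div_nonneg (by linarith) h0.le
    refine e1.trans ?_
    gcongr
  simpa using h3

end Threshold

theorem mainTheorem7 (m : ℕ) (hm : 4 ≤ m) :
    ∃ p₀ : ℝ,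
      (0 < p₀ ∧ p₀ ≤ 1 / 2 ∧ 1 - 4 / (m : ℝ) = rateBound m p₀) ∧
      (∀ q : ℝ, 0 < q → q ≤ 1 / 2 → 1 - 4 / (m : ℝ) = rateBound m q → q = p₀) ∧
      ∀ C : ℕ → CSSCode, (∀ t, (C t).IsProper m) → CSSCode.erasureThreshold C ≤ p₀ := by
  obtain ⟨d, rfl⟩ := Nat.exists_eq_add_of_le' hm
  have hcast : ((d + 4 : ℕ) : ℝ) = (d : ℝ) + 4 := by push_cast; rfl
  obtain ⟨p₀, hlow, hhalf, heq⟩ := exists_eq_rateBound d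
  have hpos : 0 < p₀ := lt_of_lt_of_le (by positivity) hlow
  refine ⟨p₀, ⟨hpos, hhalf, by rw [hcast]; exact heq⟩, fun q hq0 hq1 hq => ?_, fun C hC => ?_⟩
  · rw [hcast] at hq
    have hq2 : 1 / ((d : ℝ) + 3) ≤ q := by
      by_contra! h
      exact (lt_rateBound hq0 h.le).ne hq
    rcases lt_trichotomy q p₀ with h | h | h
    · exact absurd heq (rateBound_lt_of_eq hq2 h hhalf hq).ne'
    · exact h
    · exact absurd hq (rateBound_lt_of_eq hlow h hq1 heq).ne'
  · refine Real.sSup_le ?_ hpos.le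
    rintro p ⟨-, hp1, hp⟩
    by_contra! h
    obtain ⟨hlt, hle⟩ := le_rateBound_of_tendsto hm hC (hpos.trans h) hp1 hp
    rw [hcast] at hle
    exact absurd hle (not_le.2 (rateBound_lt_of_eq hlow h hlt.le heq))
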